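/- Let $M$ be a smooth Riemannian manifold of dimension $m+1\ge 1$, and let $k,p\ge 0$ be integers with $2p\le k$. Then the Riemannian curvature measure $C^M_{kp}$ is angular. The notions are as follows; all tangent spaces are oriented, and a change of orientation affects none of the signed measures below. *The curvature measure $C^M_{kp}$.* Let $\pi: SM\to M$ be the unit sphere bundle. For $\xi\in S_xM$ let $b=(b_0=\xi,b_1,\dots,b_m)$ be a positively oriented orthonormal frame of $T_xM$ and let, for $v,w\in T_\xi SM$, $$\theta_i(v)=\langle d\pi(v),b_i\rangle,\qquad \omega_{i0}(v)=\langle K(v),b_i\rangle,\qquad \Omega_{ij}(v,w)=\langle R(d\pi(v),d\pi(w))b_j,b_i\rangle,$$ where $K:T_\xi TM\to T_xM$ is the connection map of the Levi-Civita connection and $R$ is its curvature tensor. If $k\le m$, let $$\phi_{kp}=\sum_{\tau}\operatorname{sgn}(\tau)\,\Omega_{\tau_1\tau_2}\cdots\Omega_{\tau_{2p-1}\tau_{2p}}\,\theta_{\tau_{2p+1}}\cdots\theta_{\tau_k}\,\omega_{\tau_{k+1}0}\cdots\omega_{\tau_m0}\in\Omega^m(SM),$$ the sum being over the permutations $\tau$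 of $\{1,\dots,m\}$; if $k=m+1$, let $$\psi_p=\sum_\tau\operatorname{sgn}(\tau)\,\Omega_{\tau_0\tau_1}\cdots\Omega_{\tau_{2p-2}\tau_{2p-1}}\,\theta_{\tau_{2p}}\cdots\theta_{\tau_m}\in\Omega^{m+1}(M),$$ the sum being over the permutations of $\{0,\dots,m\}$. These forms do not depend on the choice of the frame. (If $m=0$ and the only adapted frame $(\xi)$ is negatively oriented, the value at $\xi$ is multiplied by $-1$.) Write $[\psi,\phi]$ for the curvature measure determined by $\psi\in\Omega^m(SM)$ and $\phi\in\Omega^{m+1}(M)$, and let $\omega_j$ denote the volume of the unit ball of $\mathbb R^j$. Then $$C^M_{kp}=\begin{cases}\dfrac{\omega_k}{\pi^k\,(m+1-k)!\,\omega_{m+1-k}}\,[\phi_{kp},0], & k<m+1,\\[2mm] \dfrac{\omega_k}{\pi^k}\,[0,\psi_p], & k=m+1,\\[2mm] 0,& k>m+1.\end{cases}$$ *The associated section.* For $x\in M$ and $u\in S_xM$ the Levi-Civita connection gives an isomorphism $T_uSM\cong T_xM\oplus u^\perp$ (horizontal and vertical part), and $T_xM\oplus u^\perp$ is the tangent space of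 $T_xM\times S(T_xM)$ at every point $(y,u)$. Thus $\psi\in\Omega^m(SM)$ and $\phi\in\Omega^{m+1}(M)$ determine a translation-invariant $m$-form $\psi_x$ on $T_xM\times S(T_xM)$ and a translation-invariant $(m+1)$-form $\phi_x$ on $T_xM$. For a convex polytope $P\subset T_xM$ with normal cycle $N(P)$ (the unit normal bundle of $P$ in $T_xM\times S(T_xM)$, oriented by means of the outer parallel hypersurfaces of $P$) put $$\Psi_x(P,A)=\int_{N(P)\cap (A\times S(T_xM))}\psi_x+\int_{P\cap A}\phi_x,\qquad A\subset T_xM\ \text{Borel}.$$ *Angularity.* The curvature measure $[\psi,\phi]$ on $M$ is angular if for every $x\in M$ there is a real function $c$ on the set of all linear subspaces of $T_xM$ such that for every convex polytope $P\subset T_xM$ $$\Psi_x(P,\cdot)=\sum_{j=0}^{m+1}\ \sum_{F}\ c(\vec F)\,\angle(F,P)\,\mathcal H^j|_F,$$ where $F$ ranges over the $j$-dimensional faces of $P$, $\vec F$ is the linear subspace parallel to $F$, $\angle(F,P)$ is the exterior solid angle of $P$ along $F$, and $\mathcal H^j$ is the $j$-dimensional Hausdorff measure. -/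

import Mathlib

open scoped Manifold ContDiff Bundle MeasureTheory

set_option maxSynthPendingDepth 3

noncomputable section

namespace RiemCurv

/-! ### Wedge products of two-forms and one-forms -/

section Wedge

variable {W : Type*} [AddCommGroup W] [Module ℝ W]

open Classical in
/-- The slot `i`, with all other arguments fixed, as a linear map. -/
theorem tensorProd_linear {q p : ℕ} (h : 2 * p ≤ q) (A : Fin p → W →ₗ[ℝ] W →ₗ[ℝ] ℝ)
    (a : Fin q → W →ₗ[ℝ] ℝ) (v : Fin q → W) (i : Fin q) :
    ∃ L : W →ₗ[ℝ] ℝ, ∀ x : W,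
      (∏ j : Fin p, A j (Function.update v i x ⟨2 * j, by omega⟩)
        (Function.update v i x ⟨2 * j + 1, by omega⟩)) *
      (∏ l : Fin q, if (l : ℕ) < 2 * p then 1 else a l (Function.update v i x l)) = L x := by
  by_cases hi : (i : ℕ) < 2 * p
  · have h2 : ∀ x : W,
        (∏ l : Fin q, if (l : ℕ) < 2 * p then 1 else a l (Function.update v i x l)) =
          ∏ l : Fin q, if (l : ℕ) < 2 * p then 1 else a l (v l) := by
      intro x
      refine Finset.prod_congr rfl fun l _ => ?_
      by_cases hl : (l : ℕ) < 2 * p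
      · simp [hl]
      · have : l ≠ i := fun e => hl (e ▸ hi)
        simp [hl, this]
    set j₀ : Fin p := ⟨i / 2, by omega⟩ with hj₀
    have h1 : ∀ x : W, (∏ j ∈ Finset.univ.erase j₀, A j (Function.update v i x ⟨2 * j, by omega⟩)
        (Function.update v i x ⟨2 * j + 1, by omega⟩)) =
        ∏ j ∈ Finset.univ.erase j₀, A j (v ⟨2 * j, by omega⟩) (v ⟨2 * j + 1, by omega⟩) := by
      intro x
      refine Finset.prod_congr rfl fun j hj => ?_
      have hj' : (j : ℕ) ≠ i / 2 := fun e => (Finset.ne_of_mem_erase hj) (Fin.ext e)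
      have e1 : (⟨2 * j, by omega⟩ : Fin q) ≠ i := fun e => hj' (by rw [← e]; simp)
      have e2 : (⟨2 * j + 1, by omega⟩ : Fin q) ≠ i := fun e => hj' (by rw [← e]; simp; omega)
      rw [Function.update_of_ne e1, Function.update_of_ne e2]
    set C := (∏ j ∈ Finset.univ.erase j₀, A j (v ⟨2 * j, by omega⟩) (v ⟨2 * j + 1, by omega⟩)) *
      ∏ l : Fin q, if (l : ℕ) < 2 * p then 1 else a l (v l) with hC
    rcases Nat.mod_two_eq_zero_or_one (i : ℕ) with hm | hm
    · refine ⟨C • (A j₀).flip (v ⟨2 * j₀ + 1, by omega⟩), fun x => ?_⟩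
      have e1 : (⟨2 * j₀, by omega⟩ : Fin q) = i := Fin.ext (by simp [hj₀]; omega)
      have e2 : (⟨2 * j₀ + 1, by omega⟩ : Fin q) ≠ i := fun e => by
        have := congrArg Fin.val e; simp [hj₀] at this; omega
      rw [← Finset.mul_prod_erase _ _ (Finset.mem_univ j₀), h1, h2, Function.update_of_ne e2, e1,
        Function.update_self]
      simp [hC]; ring
    · refine ⟨C • (A j₀) (v ⟨2 * j₀, by omega⟩), fun x => ?_⟩
      have e1 : (⟨2 * j₀, by omega⟩ : Fin q) ≠ i := fun e => by
        have := congrArg Fin.val e; simp [hj₀] at this; omega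
      have e2 : (⟨2 * j₀ + 1, by omega⟩ : Fin q) = i := Fin.ext (by simp [hj₀]; omega)
      rw [← Finset.mul_prod_erase _ _ (Finset.mem_univ j₀), h1, h2, Function.update_of_ne e1, e2,
        Function.update_self]
      simp [hC]; ring
  · refine ⟨((∏ j : Fin p, A j (v ⟨2 * j, by omega⟩) (v ⟨2 * j + 1, by omega⟩)) *
      ∏ l ∈ Finset.univ.erase i, if (l : ℕ) < 2 * p then 1 else a l (v l)) • a i, fun x => ?_⟩
    have h1 : (∏ j : Fin p, A j (Function.update v i x ⟨2 * j, by omega⟩)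
        (Function.update v i x ⟨2 * j + 1, by omega⟩)) =
        ∏ j : Fin p, A j (v ⟨2 * j, by omega⟩) (v ⟨2 * j + 1, by omega⟩) := by
      refine Finset.prod_congr rfl fun j _ => ?_
      have e1 : (⟨2 * j, by omega⟩ : Fin q) ≠ i := fun e => hi (by rw [← e]; simp)
      have e2 : (⟨2 * j + 1, by omega⟩ : Fin q) ≠ i := fun e => hi (by rw [← e]; simp; omega)
      rw [Function.update_of_ne e1, Function.update_of_ne e2]
    have h2 : (∏ l ∈ Finset.univ.erase i,
        if (l : ℕ) < 2 * p then 1 else a l (Function.update v i x l)) =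
        ∏ l ∈ Finset.univ.erase i, if (l : ℕ) < 2 * p then 1 else a l (v l) := by
      refine Finset.prod_congr rfl fun l hl => ?_
      rw [Function.update_of_ne (Finset.ne_of_mem_erase hl)]
    rw [h1, ← Finset.mul_prod_erase _ _ (Finset.mem_univ i), h2]
    simp [hi]; ring

/-- The multilinear map
`v ↦ A₀(v₀, v₁) ⋯ A_{p-1}(v_{2p-2}, v_{2p-1}) a_{2p}(v_{2p}) ⋯ a_{q-1}(v_{q-1})`. -/
def tensorProd {q p : ℕ} (h : 2 * p ≤ q) (A : Fin p → W →ₗ[ℝ] W →ₗ[ℝ] ℝ)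
    (a : Fin q → W →ₗ[ℝ] ℝ) : MultilinearMap ℝ (fun _ : Fin q => W) ℝ :=
  MultilinearMap.mk'
    (fun v => (∏ j : Fin p, A j (v ⟨2 * j, by omega⟩) (v ⟨2 * j + 1, by omega⟩)) *
      ∏ i : Fin q, if (i : ℕ) < 2 * p then 1 else a i (v i))
    (by
      intro v i x y
      obtain ⟨L, hL⟩ := tensorProd_linear h A a v i
      rw [hL, hL, hL, map_add])
    (by
      intro v i c x
      obtain ⟨L, hL⟩ := tensorProd_linear h A a v i
      rw [hL, hL, map_smul])

/-- The wedge product `A₀ ∧ ⋯ ∧ A_{p-1} ∧ a_{2p} ∧ ⋯ ∧ a_{q-1}` of `p` two-forms (antisymmetric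
bilinear forms) and `q - 2p` one-forms, normalized so that
`(a ∧ b)(v, w) = a(v) b(w) - a(w) b(v)`. The entries `a_i` with `i < 2p` play no role. -/
def wedge {q p : ℕ} (h : 2 * p ≤ q) (A : Fin p → W →ₗ[ℝ] W →ₗ[ℝ] ℝ)
    (a : Fin q → W →ₗ[ℝ] ℝ) : W [⋀^Fin q]→ₗ[ℝ] ℝ :=
  ((2 : ℝ) ^ p)⁻¹ • MultilinearMap.alternatization (tensorProd h A a)

end Wedge

/-! ### Oriented orthonormal frames -/

section Frames

variable {V : Type*} [NormedAddCommGroup V] [InnerProductSpace ℝ V] {m : ℕ}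

open Classical in
/-- `1` if the frame is positively oriented, `-1` otherwise. -/
def frameSign (o : Orientation ℝ V (Fin (m + 1))) (b : OrthonormalBasis (Fin (m + 1)) ℝ V) : ℝ :=
  if b.toBasis.orientation = o then 1 else -1

open Classical in
/-- The common value of `T` on the positively oriented orthonormal frames `(b₀, …, b_m)`, for a
quantity `T` that is multiplied by `det g` when the frame is moved by `g`. -/
def frameValue {A : Type*} [AddCommGroup A] [Module ℝ A] (o : Orientation ℝ V (Fin (m + 1)))
    (T : OrthonormalBasis (Fin (m + 1)) ℝ V → A) : A :=
  if h : Nonempty (OrthonormalBasis (Fin (m + 1)) ℝ V) then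
    frameSign o h.some • T h.some else 0

open Classical in
/-- The common value of `T` on the positively oriented orthonormal frames adapted to the unit
vector `u`, i.e. with `b₀ = u`, for a quantity `T` that is multiplied by `det g` when
`(b₁, …, b_m)` is moved by `g ∈ O(m)`. The sign makes sense of this also for `m = 0`, where the
only adapted frame `(u)` may be negative. -/
def adaptedFrameValue {A : Type*} [AddCommGroup A] [Module ℝ A]
    (o : Orientation ℝ V (Fin (m + 1))) (u : V)
    (T : OrthonormalBasis (Fin (m + 1)) ℝ V → A) : A :=
  if h : ∃ b : OrthonormalBasis (Fin (m + 1)) ℝ V, b 0 = u then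
    frameSign o h.choose • T h.choose else 0

end Frames

/-! ### Translation-invariant curvature measures on a euclidean space -/

section Euclidean

variable (V : Type*) [NormedAddCommGroup V] [InnerProductSpace ℝ V]

/-- A pair `(ψ, φ)` consisting of a translation-invariant `m`-form on the sphere bundle
`V × S(V)` and a translation-invariant `(m+1)`-form on `V`. The tangent space of `V × S(V)` at
`(x, u)` is `V × uᗮ ⊆ V × V`; the form `ψ` at `(x, u)` is given as (the restriction of) an
alternating form `sphereForm u` on `V × V`. Only its values for `‖u‖ = 1` and on `V × uᗮ`
matter. -/
structure InvFormPair (m : ℕ) where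
  sphereForm : V → (V × V) [⋀^Fin m]→ₗ[ℝ] ℝ
  volForm : V [⋀^Fin (m + 1)]→ₗ[ℝ] ℝ

variable {V}

open Classical in
/-- A point of `P` nearest to `y`; it is unique if `P` is nonempty, closed and convex. -/
def nearestPoint (P : Set V) (y : V) : V :=
  if h : ∃ q ∈ P, dist y q = Metric.infDist y P then h.choose else y

/-- The map `y ↦ (p, u)` from the complement of the convex body `P` to `V × S(V)`, where `p` is
the point of `P` nearest to `y` and `u` is the unit vector in the direction `y - p`. It restricts
to a bi-Lipschitz homeomorphism from the parallel hypersurface at distance one onto the unit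
normal bundle of `P`. -/
def normalMap (P : Set V) (y : V) : V × V :=
  (nearestPoint P y, ‖y - nearestPoint P y‖⁻¹ • (y - nearestPoint P y))

/-- The set of `k`-dimensional (nonempty) faces of a convex polytope, `P` itself included. -/
def faces (P : Set V) (k : ℕ) : Set (Set V) :=
  {F | F.Nonempty ∧ IsExposed ℝ P F ∧ Module.finrank ℝ (vectorSpan ℝ F) = k}

/-- The cone of outer normals of `P` along `F`. -/
def normalCone (F P : Set V) : Set V :=
  {w | ∀ p ∈ F, ∀ q ∈ P, inner ℝ w (q - p) ≤ 0}

variable [FiniteDimensional ℝ V] [MeasurableSpace V] [BorelSpace V] {m : ℕ}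

/-- `k`-dimensional Hausdorff measure on `V`, normalized so that the unit cube of `ℝᵏ` has
measure one. -/
def hausdorff (k : ℕ) : MeasureTheory.Measure V :=
  (μH[(k : ℝ)] {x : EuclideanSpace ℝ (Fin k) | ∀ i, x i ∈ Set.Icc (0 : ℝ) 1})⁻¹ • μH[(k : ℝ)]

/-- The integral of the form `ψ` over the part of the normal cycle of the convex body `P` that
lies over `E`. The normal cycle is the image under `normalMap P` of the hypersurface
`{y | dist(y, P) = 1}`, oriented as the boundary of `{y | dist(y, P) ≤ 1}`
(outer normal first). -/
def integralNormalCycle (o : Orientation ℝ V (Fin (m + 1)))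
    (ψ : V → (V × V) [⋀^Fin m]→ₗ[ℝ] ℝ) (P E : Set V) : ℝ :=
  ∫ y in {y | Metric.infDist y P = 1 ∧ (normalMap P y).1 ∈ E},
    adaptedFrameValue o (normalMap P y).2 (fun b =>
      ψ (normalMap P y).2 (fun i : Fin m => fderiv ℝ (normalMap P) y (b i.succ)))
    ∂(hausdorff m)

/-- The signed measure `Ψ(P, ·)`, evaluated at `E`, for the curvature measure `Ψ = [ψ, φ]`. -/
def InvFormPair.curvature (o : Orientation ℝ V (Fin (m + 1))) (Ψ : InvFormPair V m)
    (P E : Set V) : ℝ :=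
  integralNormalCycle o Ψ.sphereForm P E +
    ∫ _y in P ∩ E, frameValue o (fun b => Ψ.volForm b)

/-- The exterior solid angle of `P` along its face `F`: the fraction of the unit ball of the
orthogonal complement of the direction of `F` that is filled by the normal cone. -/
def exteriorAngle (F P : Set V) : ℝ :=
  let d := Module.finrank ℝ (vectorSpan ℝ F)ᗮ
  (hausdorff d (normalCone F P ∩ Metric.closedBall (0 : V) 1)).toReal /
    (hausdorff d (((vectorSpan ℝ F)ᗮ : Set V) ∩ Metric.closedBall (0 : V) 1)).toReal

/-- The translation-invariant curvature measure `Ψ` is angular: there is a function `c` on the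
(disjoint union of the) Grassmannians of `V` such that, for every convex polytope `P`,
`Ψ(P, ·) = ∑ₖ ∑_F c(F⃗) ∠(F, P) 𝓗ₖ|F`, the inner sum being over the finitely many `k`-faces. -/
def InvFormPair.IsAngular (o : Orientation ℝ V (Fin (m + 1))) (Ψ : InvFormPair V m) : Prop :=
  ∃ c : Submodule ℝ V → ℝ, ∀ s : Finset V, s.Nonempty → ∀ E : Set V, MeasurableSet E →
    Ψ.curvature o (convexHull ℝ (s : Set V)) E =
      ∑ k ∈ Finset.range (Module.finrank ℝ V + 1),
        ∑ᶠ F ∈ faces (convexHull ℝ (s : Set V)) k,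
          c (vectorSpan ℝ F) * exteriorAngle F (convexHull ℝ (s : Set V)) *
            (hausdorff k (F ∩ E)).toReal

end Euclidean

/-! ### Christoffel symbols and curvature of a metric on an open subset of a vector space -/

section Local

variable {E : Type*} [NormedAddCommGroup E] [NormedSpace ℝ E]

/-- The Christoffel symbols of the metric `g`, i.e. the bilinear map `Γ` at the point `z` such that
`2 g(Γ(u, v), w) = ∂ᵤ g(v, w) + ∂ᵥ g(u, w) - ∂_w g(u, v)`. -/
def christoffel (g : E → E →L[ℝ] E →L[ℝ] ℝ) (z : E) : E →L[ℝ] E →L[ℝ] E :=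
  let D : E →L[ℝ] E →L[ℝ] E →L[ℝ] ℝ := fderiv ℝ g z
  let K : E →L[ℝ] E →L[ℝ] E →L[ℝ] ℝ :=
    (2 : ℝ)⁻¹ • (D + D.flip -
      (ContinuousLinearMap.flipₗᵢ ℝ E E ℝ).toContinuousLinearEquiv.toContinuousLinearMap.comp
        D.flip)
  (ContinuousLinearMap.compL ℝ E (E →L[ℝ] ℝ) E (g z).inverse).comp K

/-- The curvature tensor `R(u, v)w = ∇ᵤ∇ᵥw - ∇ᵥ∇ᵤw - ∇_{[u,v]}w` of the metric `g` at `z`. -/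
def curvatureTensor (g : E → E →L[ℝ] E →L[ℝ] ℝ) (z u v w : E) : E :=
  fderiv ℝ (christoffel g) z u v w - fderiv ℝ (christoffel g) z v u w
    + christoffel g z u (christoffel g z v w) - christoffel g z v (christoffel g z u w)

/-- `(u, v) ↦ l(R(u, v)w)` as a bilinear form. -/
def curvatureBilin (g : E → E →L[ℝ] E →L[ℝ] ℝ) (z : E) (l : E →ₗ[ℝ] ℝ) (w : E) :
    E →ₗ[ℝ] E →ₗ[ℝ] ℝ :=
  LinearMap.mk₂ ℝ (fun u v => l (curvatureTensor g z u v w))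
    (fun u u' v => by simp [curvatureTensor]; ring)
    (fun c u v => by simp [curvatureTensor]; ring)
    (fun u v v' => by simp [curvatureTensor]; ring)
    (fun c u v => by simp [curvatureTensor]; ring)

end Local

/-! ### Riemannian manifolds -/

section Riemannian

variable {E : Type*} [NormedAddCommGroup E] [NormedSpace ℝ E]
  {M : Type*} [TopologicalSpace M] [ChartedSpace E M] [IsManifold 𝓘(ℝ, E) ∞ M]

instance finiteDimensionalTangent [FiniteDimensional ℝ E] (x : M) : FiniteDimensional ℝ (TangentSpace 𝓘(ℝ, E) x) :=
  inferInstanceAs (FiniteDimensional ℝ E)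

instance measurableSpaceTangent (x : M) : MeasurableSpace (TangentSpace 𝓘(ℝ, E) x) := borel _

instance borelSpaceTangent (x : M) : BorelSpace (TangentSpace 𝓘(ℝ, E) x) := ⟨rfl⟩

/-- The derivative `T_ξ(TM) → T_x M` of the projection `TM → M` at `ξ ∈ T_x M`. -/
def projDeriv (ξ : TangentBundle 𝓘(ℝ, E) M) :
    TangentSpace 𝓘(ℝ, E).tangent ξ →ₗ[ℝ] TangentSpace 𝓘(ℝ, E) ξ.proj :=
  (mfderiv 𝓘(ℝ, E).tangent 𝓘(ℝ, E) (Bundle.TotalSpace.proj : TangentBundle 𝓘(ℝ, E) M → M) ξ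
    : TangentSpace 𝓘(ℝ, E).tangent ξ →L[ℝ] TangentSpace 𝓘(ℝ, E) ξ.proj)

variable [Bundle.RiemannianBundle (fun x : M => TangentSpace 𝓘(ℝ, E) x)]

/-- The Riemannian metric read in the chart at `x`. -/
def chartMetric (x : M) (z : E) : E →L[ℝ] E →L[ℝ] ℝ :=
  let y : M := (extChartAt 𝓘(ℝ, E) x).symm z
  let L : E →L[ℝ] TangentSpace 𝓘(ℝ, E) y :=
    (trivializationAt E (TangentSpace 𝓘(ℝ, E) : M → Type _) x).symmL ℝ y
  (innerSL ℝ (E := TangentSpace 𝓘(ℝ, E) y)).bilinearComp L L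

/-- The Christoffel symbols of the Levi-Civita connection at `x`, in the chart at `x`. By
construction of `TangentSpace`, this chart identifies the tangent space at `x` with `E`. -/
def christoffelAt (x : M) : E →L[ℝ] E →L[ℝ] E :=
  christoffel (chartMetric x) (extChartAt 𝓘(ℝ, E) x x)

/-- The curvature form `Ω_ij(u, v) = ⟨b_i, R(u, v) b_j⟩` at `x`, for `bi, bj ∈ T_x M`. -/
def curvatureForm (x : M) (bi bj : TangentSpace 𝓘(ℝ, E) x) :
    TangentSpace 𝓘(ℝ, E) x →ₗ[ℝ] TangentSpace 𝓘(ℝ, E) x →ₗ[ℝ] ℝ :=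
  curvatureBilin (E := E) (chartMetric x) (extChartAt 𝓘(ℝ, E) x x)
    (innerₛₗ ℝ (E := TangentSpace 𝓘(ℝ, E) x) bi) bj

/-- The connection map `T_ξ(TM) → T_x M` of the Levi-Civita connection at `ξ ∈ T_x M`: it sends the
velocity of a vector field along a curve to the covariant derivative of that field. In the chart of
`TM` induced by the chart at `x`, which identifies `T_ξ(TM)` with `E × E`, it is
`(h, w) ↦ w + Γ(h, ξ)`. -/
def connectionMap (ξ : TangentBundle 𝓘(ℝ, E) M) :
    TangentSpace 𝓘(ℝ, E).tangent ξ →ₗ[ℝ] TangentSpace 𝓘(ℝ, E) ξ.proj :=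
  let f : E × E →ₗ[ℝ] E := LinearMap.snd ℝ E E +
    ((christoffelAt (E := E) ξ.proj).flip ξ.2).toLinearMap ∘ₗ LinearMap.fst ℝ E E
  f

/-- The isomorphism `T_x M × T_x M → T_u(TM)`, `u ∈ T_x M`, that sends `(h, w)` to the sum of the
horizontal lift of `h` and the vertical lift of `w`; it is the inverse of
`(projDeriv, connectionMap)`. It maps `T_x M × uᗮ` onto the tangent space of the sphere bundle if
`‖u‖ = 1`. -/
def liftMap (x : M) (u : TangentSpace 𝓘(ℝ, E) x) :
    (TangentSpace 𝓘(ℝ, E) x × TangentSpace 𝓘(ℝ, E) x) →ₗ[ℝ]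
      TangentSpace 𝓘(ℝ, E).tangent (⟨x, u⟩ : TangentBundle 𝓘(ℝ, E) M) :=
  let f : E × E →ₗ[ℝ] E × E := LinearMap.prod (LinearMap.fst ℝ E E)
    (LinearMap.snd ℝ E E - ((christoffelAt (E := E) x).flip u).toLinearMap ∘ₗ LinearMap.fst ℝ E E)
  f

section Realization

variable {m : ℕ}

/-- The realization `θ_i(v) = ⟨b_i, dπ(v)⟩` of the coframe forms at `ξ ∈ SM`. -/
def theta (ξ : TangentBundle 𝓘(ℝ, E) M)
    (b : OrthonormalBasis (Fin (m + 1)) ℝ (TangentSpace 𝓘(ℝ, E) ξ.proj)) (i : Fin (m + 1)) :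
    TangentSpace 𝓘(ℝ, E).tangent ξ →ₗ[ℝ] ℝ :=
  innerₛₗ ℝ (b i) ∘ₗ projDeriv ξ

/-- The realization `ω_{i0}(v) = ⟨b_i, ∇ᵥ b₀⟩` of the connection forms at `ξ ∈ SM`. For every local
section `(b₀, …, b_m)` of the bundle of adapted frames over `SM`, the vector field `b₀` along
`SM → M` is tautological, so that `∇ᵥ b₀` is the image of `v` under the connection map. -/
def omegaZero (ξ : TangentBundle 𝓘(ℝ, E) M)
    (b : OrthonormalBasis (Fin (m + 1)) ℝ (TangentSpace 𝓘(ℝ, E) ξ.proj)) (i : Fin (m + 1)) :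
    TangentSpace 𝓘(ℝ, E).tangent ξ →ₗ[ℝ] ℝ :=
  innerₛₗ ℝ (b i) ∘ₗ connectionMap ξ

/-- The realization of the curvature forms `Ω_ij` at `ξ ∈ SM`. -/
def bigOmega (ξ : TangentBundle 𝓘(ℝ, E) M)
    (b : OrthonormalBasis (Fin (m + 1)) ℝ (TangentSpace 𝓘(ℝ, E) ξ.proj)) (i j : Fin (m + 1)) :
    TangentSpace 𝓘(ℝ, E).tangent ξ →ₗ[ℝ] TangentSpace 𝓘(ℝ, E).tangent ξ →ₗ[ℝ] ℝ :=
  (curvatureForm ξ.proj (b i) (b j)).compl₁₂ (projDeriv ξ) (projDeriv ξ)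

/-- The realization at `ξ ∈ SM`, with respect to a frame `b` with `b₀ = ξ`, of
`φ_{kp} = ∑_π sgn(π) Ω_{π₁π₂} ⋯ Ω_{π_{2p-1}π_{2p}} θ_{π_{2p+1}} ⋯ θ_{π_k} ω_{π_{k+1}0} ⋯ ω_{π_m 0}`,
the sum being over the permutations of `{1, …, m}`. -/
def phiFrame (k p : ℕ) (hp : 2 * p ≤ m) (ξ : TangentBundle 𝓘(ℝ, E) M)
    (b : OrthonormalBasis (Fin (m + 1)) ℝ (TangentSpace 𝓘(ℝ, E) ξ.proj)) :
    TangentSpace 𝓘(ℝ, E).tangent ξ [⋀^Fin m]→ₗ[ℝ] ℝ :=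
  ∑ τ : Equiv.Perm (Fin m), ((Equiv.Perm.sign τ : ℤ) : ℝ) •
    wedge hp
      (fun j => bigOmega ξ b (τ ⟨2 * j, by omega⟩).succ (τ ⟨2 * j + 1, by omega⟩).succ)
      (fun i => if (i : ℕ) < k then theta ξ b (τ i).succ else omegaZero ξ b (τ i).succ)

/-- The realization at `x`, with respect to the frame `b`, of
`ψ_p = ∑_π sgn(π) Ω_{π₀π₁} ⋯ Ω_{π_{2p-2}π_{2p-1}} θ_{π_{2p}} ⋯ θ_{π_m}`, the sum being over the
permutations of `{0, …, m}`. -/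
def psiFrame (p : ℕ) (hp : 2 * p ≤ m + 1) (x : M)
    (b : OrthonormalBasis (Fin (m + 1)) ℝ (TangentSpace 𝓘(ℝ, E) x)) :
    TangentSpace 𝓘(ℝ, E) x [⋀^Fin (m + 1)]→ₗ[ℝ] ℝ :=
  ∑ τ : Equiv.Perm (Fin (m + 1)), ((Equiv.Perm.sign τ : ℤ) : ℝ) •
    wedge hp
      (fun j => curvatureForm x (b (τ ⟨2 * j, by omega⟩)) (b (τ ⟨2 * j + 1, by omega⟩)))
      (fun i => innerₛₗ ℝ (b (τ i)))

end Realization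

variable (E M) in
/-- A pair `(ψ, φ)` of an `m`-form on the sphere bundle `SM` and an `(m+1)`-form on `M`, which
represents the curvature measure `[ψ, φ]`. The form `ψ` at `ξ ∈ SM` is given as (the restriction to
the tangent space of `SM` of) an alternating form on the tangent space of `TM`. -/
structure FormPair (m : ℕ) where
  sphereForm : ∀ ξ : TangentBundle 𝓘(ℝ, E) M, TangentSpace 𝓘(ℝ, E).tangent ξ [⋀^Fin m]→ₗ[ℝ] ℝ
  volForm : ∀ x : M, TangentSpace 𝓘(ℝ, E) x [⋀^Fin (m + 1)]→ₗ[ℝ] ℝ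

/-- The value at `x` of the section of translation-invariant curvature measures on the tangent
spaces that corresponds to a curvature measure on `M`: the tangent space of `SM` at `u` is
identified with `T_x M × uᗮ`, which is the tangent space of `T_x M × S(T_x M)` at `(·, u)`, by
means of the Levi-Civita connection. -/
def FormPair.transfer {m : ℕ} (Ψ : FormPair E M m) (x : M) :
    InvFormPair (TangentSpace 𝓘(ℝ, E) x) m where
  sphereForm u := (Ψ.sphereForm ⟨x, u⟩).compLinearMap (liftMap x u)
  volForm := Ψ.volForm x

/-- A curvature measure on `M` is angular if all the values of the associated section are. -/
def FormPair.IsAngular [FiniteDimensional ℝ E] {m : ℕ}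
    (o : ∀ x : M, Orientation ℝ (TangentSpace 𝓘(ℝ, E) x) (Fin (m + 1)))
    (Ψ : FormPair E M m) : Prop :=
  ∀ x : M, (Ψ.transfer x).IsAngular (o x)

/-- The volume of the unit ball of `ℝᵏ`. -/
def ballVol (k : ℕ) : ℝ :=
  (MeasureTheory.volume (Metric.ball (0 : EuclideanSpace ℝ (Fin k)) 1)).toReal

/-- The curvature measure `C_{kp}` on the Riemannian manifold `M` of dimension `m + 1`, with tangent
spaces oriented by `o`. Reversing the orientation at `x` changes the sign of the forms over `x` and
the sign of the integrals over `T_x M` and over normal cycles in it, hence does not change the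
associated signed measures. Continuity of `o` is therefore not needed, and `M` need not be
orientable. -/
def curvC {m : ℕ} (o : ∀ x : M, Orientation ℝ (TangentSpace 𝓘(ℝ, E) x) (Fin (m + 1)))
    (k p : ℕ) (hp : 2 * p ≤ k) : FormPair E M m where
  sphereForm ξ :=
    if hk : k < m + 1 then
      (ballVol k / (Real.pi ^ k * (m + 1 - k).factorial * ballVol (m + 1 - k))) •
        adaptedFrameValue (o ξ.proj) ξ.2 (phiFrame k p (by omega) ξ)
    else 0
  volForm x :=
    if hk : k = m + 1 then
      (ballVol k / Real.pi ^ k) • frameValue (o x) (psiFrame p (by omega) x)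
    else 0

end Riemannian

end RiemCurv

end

/-! Fix `x`, write `V` for the tangent space, and let `F` be a face of a polytope `P` with direction
`W`. The normal cycle is parametrized by the hypersurface at distance one from `P`. The piece of it
over `F` is, in orthogonal coordinates `W × Wᗮ`, the product of `F` with the unit vectors of the
normal cone. There the normal map has derivative `v ↦ (P_W v, P_{Wᗮ} v)` on tangent vectors
(`fderiv_normalMap`). The pieces over distinct faces overlap only in null sets, so angularity
follows from two facts.

First, the value of the form on such tangent planes depends only on `W`, not on the unit normal `u`
(`phiSum_face_eq`). After the horizontal and vertical lift, `θ_i`, `ω_{i0}` and `Ω_{ij}` become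
`⟨b_i, P_W ·⟩`, `⟨b_i, P_{Wᗮ} ·⟩` and `R(b_i, b_j, P_W ·, P_W ·)`. The value is a double alternating
sum, over permutations `τ` of the frame and `σ` of the arguments. It does not change with the
adapted frame, so the frame may be taken to consist of `u`, a fixed basis of `W`, and normal
vectors. A term survives only if `σ` sends the first `k` positions to indices in `W` and `τ` sends
the others to normal indices. Counting then makes the splittings coincide, so that `τ` also sends
the first `k` positions to indices in `W`. Since `2p ≤ k`, the curvature factors see only the basis
of `W`; the remaining factors are Kronecker symbols or again involve `W` alone (`phiTerm_congr`).

Second, the measure of the piece over `F ∩ E` is a factor depending on `W` times `∠(F, P)` times the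
measure of `F ∩ E` (`exists_hausdorff_closedPiece_eq`). The piece lies on a translate of the unit
cylinder around `W`, on which a group of motions acts transitively. Hausdorff measure is therefore
proportional to the radial projection of the product volume on `W × Wᗮ`
(`exists_hausdorff_restrict_cylinder`), which turns a product of a set and a cone into a product of
volumes.

If `k ≥ m + 1` there is no part on the sphere bundle, and only the volume of `P` matters. -/

noncomputable section

namespace RiemCurv

/-! ### Homogeneous measures -/

section Homogeneous

open MeasureTheory Filter Topology

variable {V : Type*} [NormedAddCommGroup V] [InnerProductSpace ℝ V] [FiniteDimensional ℝ V]
  [MeasurableSpace V] [BorelSpace V]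

/-- If the balls of any given radius centered on `X` have the same `μ`-measure and the same
`ρ`-measure, where `μ ≤ ρ` and `ρ` is concentrated on `X`, then `μ` is a multiple of `ρ`. -/
theorem exists_eq_smul_of_le {X : Set V} {μ ρ : Measure V} [IsLocallyFiniteMeasure ρ]
    (hle : μ ≤ ρ) (hρ : ρ Xᶜ = 0)
    (hbμ : ∀ x ∈ X, ∀ y ∈ X, ∀ r, μ (Metric.closedBall x r) = μ (Metric.closedBall y r))
    (hbρ : ∀ x ∈ X, ∀ y ∈ X, ∀ r, ρ (Metric.closedBall x r) = ρ (Metric.closedBall y r)) :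
    ∃ c : ENNReal, c ≠ ⊤ ∧ μ = c • ρ := by
  -- The general argument needs a point at which the density is known to be a limit, hence `ρ ≠ 0`.
  rcases eq_or_ne ρ 0 with h0 | h0
  · refine ⟨0, by simp, ?_⟩
    rw [h0] at hle
    simpa using le_antisymm hle (Measure.zero_le _)
  have : IsLocallyFiniteMeasure μ := ⟨fun x => by
    obtain ⟨U, hU, h⟩ := ρ.finiteAt_nhds x
    exact ⟨U, hU, (hle U).trans_lt h⟩⟩
  have hae : ∀ᵐ x ∂ρ, x ∈ X := by
    rw [ae_iff]; exact hρ
  -- The density is the limit of the ratios of ball measures `ρ`-almost everywhere. By hypothesis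
  -- these ratios are the same at all centers in `X`, so the density is constant.
  have hlim := Besicovitch.ae_tendsto_rnDeriv μ ρ
  have : NeZero ρ := ⟨h0⟩
  obtain ⟨x₀, hx₀X, hx₀, hfin⟩ :=
    (hae.and (hlim.and (Measure.rnDeriv_lt_top μ ρ))).exists
  refine ⟨μ.rnDeriv ρ x₀, hfin.ne, ?_⟩
  have hconst : μ.rnDeriv ρ =ᵐ[ρ] fun _ => μ.rnDeriv ρ x₀ := by
    filter_upwards [hae, hlim] with x hxX hx
    refine tendsto_nhds_unique hx (hx₀.congr fun r => ?_)
    rw [hbμ x₀ hx₀X x hxX, hbρ x₀ hx₀X x hxX]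
  rw [← withDensity_const, ← withDensity_congr_ae hconst,
    Measure.withDensity_rnDeriv_eq μ ρ (Measure.absolutelyContinuous_of_le hle)]

/-- Two locally finite measures concentrated on `X`, for which the measure of a ball centered on
`X` depends only on the radius, are proportional. -/
theorem exists_eq_smul_of_closedBall {X : Set V} {μ ν : Measure V} [IsLocallyFiniteMeasure μ]
    [IsLocallyFiniteMeasure ν] (hμ : μ Xᶜ = 0) (hν : ν Xᶜ = 0) (hν0 : ν ≠ 0)
    (hbμ : ∀ x ∈ X, ∀ y ∈ X, ∀ r, μ (Metric.closedBall x r) = μ (Metric.closedBall y r))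
    (hbν : ∀ x ∈ X, ∀ y ∈ X, ∀ r, ν (Metric.closedBall x r) = ν (Metric.closedBall y r)) :
    ∃ c : ENNReal, c ≠ ⊤ ∧ μ = c • ν := by
  -- Comparing both measures with their sum makes the domination required above automatic.
  have : IsLocallyFiniteMeasure (μ + ν) := ⟨fun x => by
    obtain ⟨U, hU, h⟩ := μ.finiteAt_nhds x
    obtain ⟨T, hT, h'⟩ := ν.finiteAt_nhds x
    refine ⟨U ∩ T, inter_mem hU hT, ?_⟩
    rw [Measure.add_apply]
    exact ENNReal.add_lt_top.2 ⟨(measure_mono Set.inter_subset_left).trans_lt h,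
      (measure_mono Set.inter_subset_right).trans_lt h'⟩⟩
  have hs : (μ + ν) Xᶜ = 0 := by simp [hμ, hν]
  have hb : ∀ x ∈ X, ∀ y ∈ X, ∀ r,
      (μ + ν) (Metric.closedBall x r) = (μ + ν) (Metric.closedBall y r) := by
    intro x hx y hy r
    simp [hbμ x hx y hy r, hbν x hx y hy r]
  obtain ⟨a, ha, hμa⟩ := exists_eq_smul_of_le (Measure.le_add_right le_rfl) hs hbμ hb
  obtain ⟨b, hb, hνb⟩ := exists_eq_smul_of_le (Measure.le_add_left le_rfl) hs hbν hb
  have hb0 : b ≠ 0 := by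
    rintro rfl
    exact hν0 (by simpa using hνb)
  refine ⟨a * b⁻¹, ENNReal.mul_ne_top ha (ENNReal.inv_ne_top.2 hb0), ?_⟩
  calc μ = a • (μ + ν) := hμa
    _ = (a * b⁻¹) • b • (μ + ν) := by
        rw [smul_smul, mul_assoc, ENNReal.inv_mul_cancel hb0 hb, mul_one]
    _ = _ := by rw [← hνb]

end Homogeneous

/-! ### The cylinder over a subspace -/

section Cylinder

open MeasureTheory Filter Topology Submodule

set_option linter.unusedSectionVars false

variable {V : Type*} [NormedAddCommGroup V] [InnerProductSpace ℝ V] [FiniteDimensional ℝ V]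

theorem preimage_closedBall_isometryEquiv {X : Type*} [PseudoMetricSpace X] (g : X ≃ᵢ X) (x : X)
    (r : ℝ) : g ⁻¹' (Metric.closedBall (g x) r) = Metric.closedBall x r := by
  ext z; simp [Metric.mem_closedBall]

/-- The unit cylinder around `W`. -/
def cylinder (W : Submodule ℝ V) : Set V := {y | ‖Wᗮ.orthogonalProjectionOnto y‖ = 1}

/-- The motion of `V` that translates `W` by `a` and moves `Wᗮ` by `φ`. -/
def cylinderMotion (W : Submodule ℝ V) (a : W) (φ : Wᗮ ≃ₗᵢ[ℝ] Wᗮ) (y : V) : V :=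
  a + W.orthogonalProjectionOnto y + φ (Wᗮ.orthogonalProjectionOnto y)

variable (W : Submodule ℝ V)

theorem proj_add_left (a : W) (w : Wᗮ) : W.orthogonalProjectionOnto ((a : V) + w) = a := by
  simp [map_add]

theorem proj_add_right (a : W) (w : Wᗮ) : Wᗮ.orthogonalProjectionOnto ((a : V) + w) = w := by
  simp [map_add]

theorem proj_add_proj (y : V) :
    (W.orthogonalProjectionOnto y : V) + (Wᗮ.orthogonalProjectionOnto y : V) = y :=
  W.starProjection_add_starProjection_orthogonal y

theorem norm_add_sq_orthogonal (a : W) (w : Wᗮ) :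
    ‖(a : V) + w‖ ^ 2 = ‖a‖ ^ 2 + ‖w‖ ^ 2 := by
  have h : inner ℝ (a : V) (w : V) = 0 := w.2 a a.2
  have := norm_add_sq_eq_norm_sq_add_norm_sq_of_inner_eq_zero (a : V) (w : V) h
  simpa [sq] using this

theorem cylinderMotion_symm (a : W) (φ : Wᗮ ≃ₗᵢ[ℝ] Wᗮ) (y : V) :
    cylinderMotion W a φ (cylinderMotion W (-a) φ.symm y) = y := by
  have h : cylinderMotion W (-a) φ.symm y = ((-a + W.orthogonalProjectionOnto y : W) : V) +
      ((φ.symm (Wᗮ.orthogonalProjectionOnto y) : Wᗮ) : V) := by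
    simp [cylinderMotion]
  rw [h, cylinderMotion, proj_add_left, proj_add_right]
  simp

theorem isometry_cylinderMotion (a : W) (φ : Wᗮ ≃ₗᵢ[ℝ] Wᗮ) :
    Isometry (cylinderMotion W a φ) := by
  refine Isometry.of_dist_eq fun y z => ?_
  rw [dist_eq_norm, dist_eq_norm]
  have h1 : cylinderMotion W a φ y - cylinderMotion W a φ z =
      (W.orthogonalProjectionOnto (y - z) : V) + (φ (Wᗮ.orthogonalProjectionOnto (y - z)) : V) := by
    simp only [cylinderMotion, map_sub, Submodule.coe_sub]
    abel
  have h2 := norm_add_sq_orthogonal W (W.orthogonalProjectionOnto (y - z))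
    (φ (Wᗮ.orthogonalProjectionOnto (y - z)))
  have h3 := norm_add_sq_orthogonal W (W.orthogonalProjectionOnto (y - z))
    (Wᗮ.orthogonalProjectionOnto (y - z))
  rw [proj_add_proj] at h3
  rw [LinearIsometryEquiv.norm_map, ← h3] at h2
  rw [h1]
  exact (pow_left_inj₀ (norm_nonneg _) (norm_nonneg _) two_ne_zero).1 h2

/-- The motion `cylinderMotion` as an isometric equivalence. -/
def cylinderIsometry (a : W) (φ : Wᗮ ≃ₗᵢ[ℝ] Wᗮ) : V ≃ᵢ V :=
  IsometryEquiv.mk' (cylinderMotion W a φ) (cylinderMotion W (-a) φ.symm)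
    (cylinderMotion_symm W a φ) (isometry_cylinderMotion W a φ)

theorem cylinderIsometry_apply (a : W) (φ : Wᗮ ≃ₗᵢ[ℝ] Wᗮ) (y : V) :
    cylinderIsometry W a φ y = cylinderMotion W a φ y := rfl

theorem cylinderMotion_mem_iff (a : W) (φ : Wᗮ ≃ₗᵢ[ℝ] Wᗮ) (y : V) :
    cylinderMotion W a φ y ∈ cylinder W ↔ y ∈ cylinder W := by
  have h : cylinderMotion W a φ y = ((a + W.orthogonalProjectionOnto y : W) : V) +
      (φ (Wᗮ.orthogonalProjectionOnto y) : V) := by simp [cylinderMotion]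
  simp only [cylinder, Set.mem_ofPred_eq]
  rw [h, proj_add_right, LinearIsometryEquiv.norm_map]

/-- Translations act transitively on `W`, and a reflection exchanges any two vectors of equal norm
in `Wᗮ`. This transitivity is what makes the measures of balls independent of their centers. -/
theorem exists_cylinderMotion_eq {x y : V} (hx : x ∈ cylinder W) (hy : y ∈ cylinder W) :
    ∃ (a : W) (φ : Wᗮ ≃ₗᵢ[ℝ] Wᗮ), cylinderMotion W a φ x = y := by
  set u := Wᗮ.orthogonalProjectionOnto x with hu
  set v := Wᗮ.orthogonalProjectionOnto y with hv
  have huv : ‖u‖ = ‖v‖ := (show ‖u‖ = 1 from hx).trans (show ‖v‖ = 1 from hy).symm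
  refine ⟨W.orthogonalProjectionOnto y - W.orthogonalProjectionOnto x,
    (ℝ ∙ (u - v))ᗮ.reflection, ?_⟩
  rw [cylinderMotion, ← hu, reflection_sub huv, hv]
  simp

theorem isClosed_cylinder : IsClosed (cylinder W) :=
  isClosed_eq (by fun_prop) continuous_const

variable [MeasurableSpace V] [BorelSpace V]

/-- The retraction onto the cylinder. -/
def cylinderRetract (z : W × Wᗮ) : V := (z.1 : V) + ‖z.2‖⁻¹ • (z.2 : V)

/-- The part of `W × Wᗮ` at distance at most one from `W`, with `W` removed. -/
def solidCylinder : Set (W × Wᗮ) := {z | 0 < ‖z.2‖ ∧ ‖z.2‖ ≤ 1}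

/-- The measure on the unit cylinder around `W` obtained by projecting the solid cylinder onto
it. -/
def cylinderMeasure : Measure V :=
  (((volume : Measure W).prod (volume : Measure Wᗮ)).restrict (solidCylinder W)).map
    (cylinderRetract W)

theorem measurable_cylinderRetract : Measurable (cylinderRetract W) := by
  unfold cylinderRetract
  fun_prop

theorem measurableSet_solidCylinder : MeasurableSet (solidCylinder W) := by
  unfold solidCylinder
  measurability

theorem cylinderMeasure_apply {S : Set V} (hS : MeasurableSet S) :
    cylinderMeasure W S = ((volume : Measure W).prod (volume : Measure Wᗮ))
      (cylinderRetract W ⁻¹' S ∩ solidCylinder W) := by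
  rw [cylinderMeasure, Measure.map_apply (measurable_cylinderRetract W) hS,
    Measure.restrict_apply (measurable_cylinderRetract W hS)]

theorem cylinderRetract_eq (z : W × Wᗮ) :
    cylinderRetract W z = (z.1 : V) + ((‖z.2‖⁻¹ • z.2 : Wᗮ) : V) := rfl

theorem cylinderRetract_mem {z : W × Wᗮ} (hz : z ∈ solidCylinder W) :
    cylinderRetract W z ∈ cylinder W := by
  rw [cylinderRetract_eq, cylinder, Set.mem_ofPred_eq, proj_add_right, norm_smul, norm_inv,
    norm_norm, inv_mul_cancel₀ hz.1.ne']

theorem cylinderMeasure_compl : cylinderMeasure W (cylinder W)ᶜ = 0 := by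
  rw [cylinderMeasure_apply W (isClosed_cylinder W).measurableSet.compl]
  have h : cylinderRetract W ⁻¹' (cylinder W)ᶜ ∩ solidCylinder W = ∅ :=
    Set.eq_empty_of_forall_notMem fun z hz => hz.1 (cylinderRetract_mem W hz.2)
  rw [h, measure_empty]

/-- For `W = ⊤` there are no unit normals and the cylinder is empty; otherwise the solid cylinder
contains a nonempty open set. -/
theorem cylinderMeasure_ne_zero (hW : W ≠ ⊤) : cylinderMeasure W ≠ 0 := by
  intro h
  have : Nontrivial Wᗮ := by
    rw [Submodule.nontrivial_iff_ne_bot]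
    exact fun e => hW ((Submodule.orthogonal_eq_bot_iff).1 e)
  have h1 : cylinderMeasure W Set.univ = 0 := by rw [h]; rfl
  rw [cylinderMeasure_apply W MeasurableSet.univ, Set.preimage_univ, Set.univ_inter] at h1
  have hn : Continuous fun z : W × Wᗮ => ‖z.2‖ := by fun_prop
  have hopen : IsOpen {z : W × Wᗮ | 0 < ‖z.2‖ ∧ ‖z.2‖ < 1} :=
    isOpen_Ioo.preimage hn
  have hne : {z : W × Wᗮ | 0 < ‖z.2‖ ∧ ‖z.2‖ < 1}.Nonempty := by
    obtain ⟨w, hw⟩ := exists_norm_eq Wᗮ (c := 1 / 2) (by norm_num)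
    exact ⟨(0, w), by
      rw [Set.mem_ofPred_eq]
      change 0 < ‖w‖ ∧ ‖w‖ < 1
      rw [hw]; norm_num⟩
  refine (hopen.measure_pos ((volume : Measure W).prod (volume : Measure Wᗮ)) hne).ne' ?_
  refine measure_mono_null ?_ h1
  rintro z ⟨hz1, hz2⟩
  exact ⟨hz1, hz2.le⟩

/-- The retraction is equivariant: the motion upstairs is a translation of `W` times an isometry of
`Wᗮ`, which preserves the product volume and the solid cylinder. -/
theorem cylinderMeasure_motion (a : W) (φ : Wᗮ ≃ₗᵢ[ℝ] Wᗮ) {S : Set V} (hS : MeasurableSet S) :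
    cylinderMeasure W (cylinderIsometry W a φ ⁻¹' S) = cylinderMeasure W S := by
  have hmp : MeasurePreserving (Prod.map (fun w => a + w) φ)
      ((volume : Measure W).prod (volume : Measure Wᗮ))
      ((volume : Measure W).prod (volume : Measure Wᗮ)) :=
    (measurePreserving_add_left volume a).prod φ.measurePreserving
  have hS' := measurable_cylinderRetract W hS
  rw [cylinderMeasure_apply W hS, cylinderMeasure_apply W
    ((cylinderIsometry W a φ).continuous.measurable hS),
    ← hmp.measure_preimage (hS'.inter (measurableSet_solidCylinder W)).nullMeasurableSet]
  congr 1
  ext ⟨w, z⟩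
  have : cylinderIsometry W a φ (cylinderRetract W (w, z)) =
      cylinderRetract W (a + w, φ z) := by
    rw [cylinderIsometry_apply, cylinderMotion, cylinderRetract_eq, proj_add_left, proj_add_right,
      cylinderRetract_eq]
    simp
  simp only [solidCylinder, Set.mem_inter_iff, Set.mem_preimage, this, Prod.map_apply,
    Set.mem_ofPred_eq, LinearIsometryEquiv.norm_map]

instance isLocallyFiniteMeasure_cylinderMeasure : IsLocallyFiniteMeasure (cylinderMeasure W) := by
  refine ⟨fun x => ⟨Metric.closedBall x 1, Metric.closedBall_mem_nhds x one_pos, ?_⟩⟩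
  rw [cylinderMeasure_apply W Metric.isClosed_closedBall.measurableSet]
  refine lt_of_le_of_lt (measure_mono (t := Metric.closedBall (0 : W) (‖x‖ + 1) ×ˢ
    Metric.closedBall (0 : Wᗮ) 1) ?_) ?_
  · rintro ⟨w, z⟩ ⟨h1, h2⟩
    refine ⟨?_, by simpa using h2.2⟩
    have h3 := norm_add_sq_orthogonal W w (‖z‖⁻¹ • z)
    have h4 : ‖cylinderRetract W (w, z)‖ ≤ ‖x‖ + 1 := by
      have := norm_sub_norm_le (cylinderRetract W (w, z)) x
      have h5 : dist (cylinderRetract W (w, z)) x ≤ 1 := h1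
      rw [dist_eq_norm] at h5
      linarith
    rw [cylinderRetract_eq] at h4
    have h6 : ‖w‖ ≤ ‖(w : V) + ((‖z‖⁻¹ • z : Wᗮ) : V)‖ := by
      refine le_of_sq_le_sq ?_ (norm_nonneg _)
      rw [h3]
      nlinarith [sq_nonneg ‖‖z‖⁻¹ • z‖]
    simpa using h6.trans h4
  · rw [Measure.prod_prod]
    exact ENNReal.mul_lt_top (isCompact_closedBall _ _).measure_lt_top
      (isCompact_closedBall _ _).measure_lt_top

/-- The chart `h ↦ P h + (Q h + u) / ‖Q h + u‖` of the cylinder, for `P`, `Q` the projections onto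
`W` and `Wᗮ`. -/
def cylinderChart (u : V) (h : V) : V :=
  W.starProjection h + ‖Wᗮ.starProjection h + u‖⁻¹ • (Wᗮ.starProjection h + u)

/-- Near `x` the cylinder is the image of a ball of the hyperplane `uᗮ` under a `C¹` chart. This
chart is Lipschitz on compact sets, and Hausdorff measure is finite on compact sets of an
`m`-dimensional space. -/
theorem hausdorffMeasure_cylinder_lt_top {m : ℕ} (hdim : Module.finrank ℝ V = m + 1) (x : V)
    (hx : x ∈ cylinder W) :
    ∃ U ∈ 𝓝 x, (μH[(m : ℝ)] : Measure V) (U ∩ cylinder W) < ⊤ := by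
  set u : V := Wᗮ.starProjection x with hu
  have huW : u ∈ Wᗮ := Wᗮ.starProjection_apply_mem x
  have hu1 : ‖u‖ = 1 := hx
  have hu0 : u ≠ 0 := by
    intro h; rw [h] at hu1; simp at hu1
  set H : Submodule ℝ V := (ℝ ∙ u)ᗮ with hH
  have hHm : Module.finrank ℝ H = m := by
    have : Fact (Module.finrank ℝ V = m + 1) := ⟨hdim⟩
    exact Submodule.finrank_orthogonal_span_singleton hu0
  have hne : ∀ h : H, Wᗮ.starProjection (h : V) + u ≠ 0 := by
    intro h e
    have h1 : inner ℝ u (Wᗮ.starProjection (h : V)) = 0 := by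
      rw [← inner_starProjection_left_eq_right, starProjection_eq_self_iff.2 huW]
      exact (mem_orthogonal_singleton_iff_inner_right).1 h.2
    have h2 : inner ℝ u (Wᗮ.starProjection (h : V) + u) = 1 := by
      rw [inner_add_right, h1, real_inner_self_eq_norm_sq, hu1]; norm_num
    rw [e] at h2; simp at h2
  set f : H → V := fun h => cylinderChart W u h with hf
  have hfC : ContDiff ℝ 1 f := by
    have h1 : ContDiff ℝ 1 fun h : H => Wᗮ.starProjection (h : V) + u := by
      exact ((Wᗮ.starProjection.comp H.subtypeL).contDiff).add contDiff_const
    have h2 : ContDiff ℝ 1 fun h : H => W.starProjection (h : V) :=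
      (W.starProjection.comp H.subtypeL).contDiff
    exact h2.add (((h1.norm ℝ hne).inv fun h => norm_ne_zero_iff.2 (hne h)).smul h1)
  set K : Set H := Metric.closedBall 0 (‖x‖ + 5)
  have hK : IsCompact K := isCompact_closedBall _ _
  obtain ⟨C, hC⟩ := LocallyLipschitzOn.exists_lipschitzOnWith_of_compact hK
    hfC.locallyLipschitz.locallyLipschitzOn
  -- The bound `1/2` keeps the central projection of the normal part onto the tangent hyperplane
  -- within norm `2`. The preimages then have norm at most `(‖x‖ + 1) + 2 + 1`, which is below the
  -- radius of `K`.
  refine ⟨Metric.ball x 1 ∩ {y | 1 / 2 < inner ℝ u y}, inter_mem (Metric.ball_mem_nhds x one_pos)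
    ?_, ?_⟩
  · refine (isOpen_lt continuous_const (by fun_prop)).mem_nhds ?_
    have : inner ℝ u x = 1 := by
      nth_rewrite 1 [← starProjection_eq_self_iff.2 huW]
      rw [inner_starProjection_left_eq_right, ← hu, real_inner_self_eq_norm_sq, hu1]; norm_num
    simp only [Set.mem_ofPred_eq, this]; norm_num
  · refine lt_of_le_of_lt (measure_mono (t := f '' K) ?_) ?_
    · rintro y ⟨⟨hy1, hy2⟩, hy3⟩
      set t := inner ℝ u y with ht
      have ht' : (1 : ℝ) / 2 < t := hy2
      have ht0 : 0 < t := by linarith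
      set v := Wᗮ.starProjection y with hv
      have hv1 : ‖v‖ = 1 := hy3
      have htv : inner ℝ u v = t := by
        rw [hv, ← inner_starProjection_left_eq_right, starProjection_eq_self_iff.2 huW]
      have hyv : W.starProjection y + v = y := W.starProjection_add_starProjection_orthogonal y
      have hvW : v ∈ Wᗮ := Wᗮ.starProjection_apply_mem y
      have hpW : W.starProjection y ∈ W := W.starProjection_apply_mem y
      -- The preimage of `y` under the chart: rescale the normal part `v` until it meets the affine
      -- hyperplane `u + uᗮ`, then subtract `u`.
      have hmem : W.starProjection y + (t⁻¹ • v - u) ∈ H := by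
        rw [hH, mem_orthogonal_singleton_iff_inner_right, inner_add_right, inner_sub_right,
          inner_smul_right, htv, real_inner_self_eq_norm_sq, hu1,
          Submodule.inner_left_of_mem_orthogonal hpW huW, inv_mul_cancel₀ ht0.ne']
        norm_num
      have hq : t⁻¹ • v - u ∈ Wᗮ := sub_mem (Wᗮ.smul_mem _ hvW) huW
      refine ⟨⟨_, hmem⟩, ?_, ?_⟩
      · rw [mem_closedBall_zero_iff]
        change ‖W.starProjection y + (t⁻¹ • v - u)‖ ≤ _
        have h1 : ‖W.starProjection y‖ ≤ ‖x‖ + 1 := by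
          refine (W.norm_starProjection_apply_le y).trans ?_
          have := norm_sub_norm_le y x
          rw [Metric.mem_ball, dist_eq_norm] at hy1
          linarith
        have h2 : ‖t⁻¹ • v‖ ≤ 2 := by
          rw [norm_smul, hv1, mul_one, Real.norm_of_nonneg (inv_nonneg.2 ht0.le),
            inv_le_comm₀ ht0 two_pos]
          linarith
        have h3 := norm_add_le (W.starProjection y) (t⁻¹ • v - u)
        have h4 := norm_sub_le (t⁻¹ • v) u
        linarith
      · have e1 : W.starProjection (W.starProjection y + (t⁻¹ • v - u)) = W.starProjection y := by
          rw [map_add, starProjection_eq_self_iff.2 hpW,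
            (starProjection_apply_eq_zero_iff _).2 hq, add_zero]
        have e2 : Wᗮ.starProjection (W.starProjection y + (t⁻¹ • v - u)) = t⁻¹ • v - u := by
          rw [map_add, starProjection_eq_self_iff.2 hq, (starProjection_apply_eq_zero_iff _).2
            (by rwa [orthogonal_orthogonal]), zero_add]
        simp only [hf, cylinderChart]
        rw [e1, e2, sub_add_cancel, norm_smul, hv1, mul_one,
          Real.norm_of_nonneg (inv_nonneg.2 ht0.le), inv_inv, smul_smul, mul_inv_cancel₀ ht0.ne',
          one_smul, hyv]
    · refine lt_of_le_of_lt (hC.hausdorffMeasure_image_le (Nat.cast_nonneg m)) ?_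
      refine ENNReal.mul_lt_top (ENNReal.rpow_lt_top_of_nonneg (Nat.cast_nonneg m) (by simp)) ?_
      rw [← hHm]
      exact hK.measure_lt_top

theorem isLocallyFiniteMeasure_hausdorff_cylinder {m : ℕ} (hdim : Module.finrank ℝ V = m + 1) :
    IsLocallyFiniteMeasure ((μH[(m : ℝ)] : Measure V).restrict (cylinder W)) := by
  refine ⟨fun x => ?_⟩
  by_cases hx : x ∈ cylinder W
  · obtain ⟨U, hU, h⟩ := hausdorffMeasure_cylinder_lt_top W hdim x hx
    refine ⟨U, hU, ?_⟩
    rwa [Measure.restrict_apply' (isClosed_cylinder W).measurableSet]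
  · refine ⟨(cylinder W)ᶜ, (isClosed_cylinder W).isOpen_compl.mem_nhds hx, ?_⟩
    rw [Measure.restrict_apply' (isClosed_cylinder W).measurableSet]
    simp

/-- On the unit cylinder around `W`, the Hausdorff measure is a multiple of
`cylinderMeasure W`. -/
theorem exists_hausdorff_restrict_cylinder {m : ℕ} (hdim : Module.finrank ℝ V = m + 1)
    (hW : W ≠ ⊤) :
    ∃ c : ENNReal, c ≠ ⊤ ∧
      (μH[(m : ℝ)] : Measure V).restrict (cylinder W) = c • cylinderMeasure W := by
  have := isLocallyFiniteMeasure_hausdorff_cylinder W hdim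
  refine exists_eq_smul_of_closedBall (X := cylinder W) ?_ (cylinderMeasure_compl W)
    (cylinderMeasure_ne_zero W hW) ?_ ?_
  · rw [Measure.restrict_apply' (isClosed_cylinder W).measurableSet]; simp
  -- Both measures are invariant under the cylinder motions, and these carry `x` to `y`.
  · intro x hx y hy r
    obtain ⟨a, φ, rfl⟩ := exists_cylinderMotion_eq W hx hy
    rw [Measure.restrict_apply' (isClosed_cylinder W).measurableSet,
      Measure.restrict_apply' (isClosed_cylinder W).measurableSet,
      ← (cylinderIsometry W a φ).hausdorffMeasure_preimage m
        (Metric.closedBall (cylinderMotion W a φ x) r ∩ cylinder W), Set.preimage_inter,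
      ← cylinderIsometry_apply, preimage_closedBall_isometryEquiv]
    congr 2
    ext z
    exact (cylinderMotion_mem_iff W a φ z).symm
  · intro x hx y hy r
    obtain ⟨a, φ, rfl⟩ := exists_cylinderMotion_eq W hx hy
    rw [← cylinderMeasure_motion W a φ (S := Metric.closedBall (cylinderMotion W a φ x) r)
      Metric.isClosed_closedBall.measurableSet,
      ← cylinderIsometry_apply, preimage_closedBall_isometryEquiv]

/-- The `m`-dimensional measure of the part of the unit cylinder around `W` that lies over `A ⊆ W`
and over a cone `N ⊆ Wᗮ`. -/
theorem exists_hausdorff_cylinder_eq {m : ℕ} (hdim : Module.finrank ℝ V = m + 1) (hW : W ≠ ⊤) :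
    ∃ c : ENNReal, c ≠ ⊤ ∧ ∀ (A : Set W) (N : Set Wᗮ), MeasurableSet A → MeasurableSet N →
      (∀ t : ℝ, 0 < t → ∀ w ∈ N, t • w ∈ N) →
      (μH[(m : ℝ)] : Measure V) {y | W.orthogonalProjectionOnto y ∈ A ∧
        Wᗮ.orthogonalProjectionOnto y ∈ N ∧ ‖Wᗮ.orthogonalProjectionOnto y‖ = 1} =
      c * (volume A * volume (N ∩ Metric.closedBall 0 1)) := by
  obtain ⟨c, hc, h⟩ := exists_hausdorff_restrict_cylinder W hdim hW
  refine ⟨c, hc, fun A N hA hN hcone => ?_⟩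
  have : Nontrivial Wᗮ := by
    rw [Submodule.nontrivial_iff_ne_bot]
    exact fun e => hW ((Submodule.orthogonal_eq_bot_iff).1 e)
  set S : Set V := {y | W.orthogonalProjectionOnto y ∈ A ∧ Wᗮ.orthogonalProjectionOnto y ∈ N}
    with hSdef
  have hS : MeasurableSet S :=
    (W.orthogonalProjectionOnto.continuous.measurable hA).inter
      (Wᗮ.orthogonalProjectionOnto.continuous.measurable hN)
  have h1 : {y | W.orthogonalProjectionOnto y ∈ A ∧
      Wᗮ.orthogonalProjectionOnto y ∈ N ∧ ‖Wᗮ.orthogonalProjectionOnto y‖ = 1} =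
      S ∩ cylinder W := by
    ext y; simp [hSdef, cylinder, and_assoc]
  rw [h1, ← Measure.restrict_apply' (isClosed_cylinder W).measurableSet, h, Measure.smul_apply,
    smul_eq_mul, cylinderMeasure_apply W hS]
  congr 1
  -- As `N` is a cone, radial projection does not affect membership in `N`, so the preimage is a
  -- product, up to the removed origin.
  have h2 : cylinderRetract W ⁻¹' S ∩ solidCylinder W =
      A ×ˢ ((N ∩ Metric.closedBall 0 1) \ {0}) := by
    ext ⟨a, w⟩
    simp only [Set.mem_inter_iff, Set.mem_preimage, Set.mem_prod, Set.mem_sdiff,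
      Set.mem_singleton_iff, mem_closedBall_zero_iff, solidCylinder, Set.mem_ofPred_eq, hSdef,
      cylinderRetract_eq, proj_add_left, proj_add_right, norm_pos_iff]
    constructor
    · rintro ⟨⟨ha, hw⟩, h0, h1⟩
      refine ⟨ha, ⟨?_, h1⟩, h0⟩
      have := hcone ‖w‖ (norm_pos_iff.2 h0) _ hw
      rwa [smul_smul, mul_inv_cancel₀ (norm_ne_zero_iff.2 h0), one_smul] at this
    · rintro ⟨ha, ⟨hw, h1⟩, h0⟩
      exact ⟨⟨ha, hcone _ (inv_pos.2 (norm_pos_iff.2 h0)) _ hw⟩, h0, h1⟩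
  rw [h2, Measure.prod_prod, measure_sdiff_null (measure_singleton _)]

end Cylinder

/-! ### Nearest points and faces of polytopes -/

section Polytope

open MeasureTheory Filter Topology Submodule

set_option linter.unusedSectionVars false

variable {V : Type*} [NormedAddCommGroup V] [InnerProductSpace ℝ V]

/-! ### Metric projection onto a compact convex set -/

section Nearest

variable {P : Set V}

theorem nearestPoint_spec (hP : IsCompact P) (hne : P.Nonempty) (y : V) :
    nearestPoint P y ∈ P ∧ dist y (nearestPoint P y) = Metric.infDist y P := by
  have h : ∃ q ∈ P, dist y q = Metric.infDist y P := by
    obtain ⟨q, hq, e⟩ := hP.exists_infDist_eq_dist hne y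
    exact ⟨q, hq, e.symm⟩
  rw [nearestPoint, dif_pos h]
  exact h.choose_spec

theorem inner_sub_nearestPoint_nonpos (hP : IsCompact P) (hc : Convex ℝ P) (hne : P.Nonempty)
    (y : V) {q : V} (hq : q ∈ P) :
    inner ℝ (y - nearestPoint P y) (q - nearestPoint P y) ≤ 0 := by
  obtain ⟨h1, h2⟩ := nearestPoint_spec hP hne y
  refine (norm_eq_iInf_iff_real_inner_le_zero hc h1).1 ?_ q hq
  rw [Metric.infDist_eq_iInf] at h2
  simpa only [dist_eq_norm] using h2

/-- The sum of the variational inequalities at two nearest points. It yields both uniqueness (`y =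
z`) and the Lipschitz constant `1` of the metric projection. -/
theorem norm_sub_sq_le_of_inner_nonpos {y z p q : V} (hp : inner ℝ (y - p) (q - p) ≤ 0)
    (hq : inner ℝ (z - q) (p - q) ≤ 0) : ‖p - q‖ ^ 2 ≤ inner ℝ (y - z) (p - q) := by
  have e : inner ℝ (y - z) (p - q) - ‖p - q‖ ^ 2 =
      - inner ℝ (y - p) (q - p) - inner ℝ (z - q) (p - q) := by
    rw [← real_inner_self_eq_norm_sq]
    simp only [inner_sub_left, inner_sub_right, real_inner_comm]
    ring
  linarith

theorem nearestPoint_eq (hP : IsCompact P) (hc : Convex ℝ P) {p y : V} (hp : p ∈ P)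
    (h : ∀ q ∈ P, inner ℝ (y - p) (q - p) ≤ 0) : nearestPoint P y = p := by
  have h1 := (nearestPoint_spec hP ⟨p, hp⟩ y).1
  have h2 := norm_sub_sq_le_of_inner_nonpos (inner_sub_nearestPoint_nonpos hP hc ⟨p, hp⟩ y hp)
    (h _ h1)
  rw [sub_self, inner_zero_left] at h2
  exact sub_eq_zero.1 (norm_eq_zero.1 (pow_eq_zero_iff two_ne_zero |>.1
    (le_antisymm h2 (sq_nonneg _))))

theorem continuous_nearestPoint (hP : IsCompact P) (hc : Convex ℝ P) (hne : P.Nonempty) :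
    Continuous (nearestPoint P) := by
  refine (LipschitzWith.of_dist_le_mul (K := 1) fun y z => ?_).continuous
  have h := norm_sub_sq_le_of_inner_nonpos
    (inner_sub_nearestPoint_nonpos hP hc hne y (nearestPoint_spec hP hne z).1)
    (inner_sub_nearestPoint_nonpos hP hc hne z (nearestPoint_spec hP hne y).1)
  have hle := h.trans (real_inner_le_norm _ _)
  rw [dist_eq_norm, dist_eq_norm, NNReal.coe_one, one_mul]
  rcases (norm_nonneg (nearestPoint P y - nearestPoint P z)).eq_or_lt with e | e
  · rw [← e]; exact norm_nonneg _
  · rw [sq] at hle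
    exact le_of_mul_le_mul_right hle e

end Nearest

/-- The nonempty exposed faces of `P`, of all dimensions. -/
def allFaces (P : Set V) : Set (Set V) := {F | F.Nonempty ∧ IsExposed ℝ P F}

/-- By Krein–Milman a face is determined by its extreme points, which are extreme points of `P` and
hence lie in the finite set `s`. -/
theorem finite_allFaces (s : Finset V) : (allFaces (convexHull ℝ (s : Set V))).Finite := by
  have hP : IsCompact (convexHull ℝ (s : Set V)) := s.finite_toSet.isCompact_convexHull ℝ
  refine Set.Finite.of_finite_image (f := fun F : Set V => F.extremePoints ℝ)
    ((s.finite_toSet.finite_subsets).subset ?_) ?_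
  · rintro _ ⟨F, hF, rfl⟩
    exact (hF.2.isExtreme.extremePoints_subset_extremePoints).trans extremePoints_convexHull_subset
  · intro F hF G hG h
    have hc : Convex ℝ (convexHull ℝ (s : Set V)) := convex_convexHull ℝ _
    rw [← closure_convexHull_extremePoints (hF.2.isCompact hP) (hF.2.convex hc),
      ← closure_convexHull_extremePoints (hG.2.isCompact hP) (hG.2.convex hc)]
    exact congrArg (fun A => closure (convexHull ℝ A)) h

/-- For two points of `F` the defining inequality holds in both orders, so it is an equality. -/
theorem normalCone_subset_orthogonal {F P : Set V} (hFP : F ⊆ P) :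
    normalCone F P ⊆ (vectorSpan ℝ F)ᗮ := by
  intro w hw
  rw [SetLike.mem_coe, vectorSpan_def, mem_orthogonal']
  intro v hv
  induction hv using Submodule.span_induction with
  | mem x hx =>
    obtain ⟨p, hp, q, hq, rfl⟩ := hx
    have h1 := hw p hp q (hFP hq)
    have h2 := hw q hq p (hFP hp)
    rw [← neg_sub, inner_neg_right] at h1
    simp only [vsub_eq_sub] at *
    linarith
  | zero => simp
  | add x y _ _ hx hy => rw [inner_add_right, hx, hy, add_zero]
  | smul c x _ hx => rw [inner_smul_right, hx, mul_zero]

theorem convex_normalCone (F P : Set V) : Convex ℝ (normalCone F P) := by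
  intro v hv w hw a b ha hb _ p hp q hq
  rw [inner_add_left, inner_smul_left, inner_smul_left]
  have h1 := hv p hp q hq
  have h2 := hw p hp q hq
  simp only [conj_trivial]
  nlinarith [mul_nonneg ha (neg_nonneg.2 h1), mul_nonneg hb (neg_nonneg.2 h2)]

theorem isClosed_normalCone (F P : Set V) : IsClosed (normalCone F P) := by
  have : normalCone F P = ⋂ p ∈ F, ⋂ q ∈ P, {w : V | inner ℝ w (q - p) ≤ 0} := by
    ext w; simp [normalCone]
  rw [this]
  exact isClosed_biInter fun p _ => isClosed_biInter fun q _ =>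
    isClosed_le (by fun_prop) continuous_const

theorem smul_mem_normalCone {F P : Set V} {w : V} (hw : w ∈ normalCone F P) {t : ℝ} (ht : 0 ≤ t) :
    t • w ∈ normalCone F P := by
  intro p hp q hq
  rw [inner_smul_left]
  exact mul_nonpos_of_nonneg_of_nonpos ht (hw p hp q hq)

/-- A point of `F`, if there is one. -/
def basePoint (F : Set V) : V := Classical.epsilon (· ∈ F)

theorem basePoint_mem {F : Set V} (h : F.Nonempty) : basePoint F ∈ F :=
  Classical.epsilon_spec h

/-- The set `F`, moved into its direction. -/
def directionPart (F : Set V) : Set (vectorSpan ℝ F) := {a | basePoint F + (a : V) ∈ F}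

/-- The normal cone of `P` along `F`, as a subset of the orthogonal complement of the direction
of `F`. -/
def normalPart (F P : Set V) : Set (vectorSpan ℝ F)ᗮ := {w | (w : V) ∈ normalCone F P}

variable [FiniteDimensional ℝ V]

/-- The points of `V` at distance one from `aff F` whose position relative to `F` is described by
`A` and `N`. -/
def facePiece (F : Set V) (A : Set (vectorSpan ℝ F)) (N : Set (vectorSpan ℝ F)ᗮ) : Set V :=
  {y | (vectorSpan ℝ F).orthogonalProjectionOnto (y - basePoint F) ∈ A ∧
    (vectorSpan ℝ F)ᗮ.orthogonalProjectionOnto (y - basePoint F) ∈ N ∧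
    ‖(vectorSpan ℝ F)ᗮ.orthogonalProjectionOnto (y - basePoint F)‖ = 1}

/-- The part of the parallel hypersurface of `P` at distance one that lies over `F`. -/
abbrev closedPiece (F P : Set V) : Set V := facePiece F (directionPart F) (normalPart F P)

/-- The relative interior of `closedPiece F P`. -/
abbrev openPiece (F P : Set V) : Set V :=
  facePiece F (interior (directionPart F)) (interior (normalPart F P))

theorem facePiece_mono {F : Set V} {A A' : Set (vectorSpan ℝ F)} {N N' : Set (vectorSpan ℝ F)ᗮ}
    (hA : A ⊆ A') (hN : N ⊆ N') : facePiece F A N ⊆ facePiece F A' N' :=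
  fun _ hy => ⟨hA hy.1, hN hy.2.1, hy.2.2⟩

theorem openPiece_subset (F P : Set V) : openPiece F P ⊆ closedPiece F P :=
  facePiece_mono interior_subset interior_subset

theorem basePoint_decomposition (F : Set V) (y : V) :
    y - (basePoint F + (vectorSpan ℝ F).orthogonalProjectionOnto (y - basePoint F)) =
      (vectorSpan ℝ F)ᗮ.orthogonalProjectionOnto (y - basePoint F) := by
  have := proj_add_proj (vectorSpan ℝ F) (y - basePoint F)
  rw [← sub_sub, sub_eq_iff_eq_add', this]

/-! ### Pieces of the parallel hypersurface over a face -/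

section Piece

variable {F P : Set V}

/-- No condition on the distance is imposed: with the interiors of both parts the formula holds on
an open subset of `V`, so it can be differentiated. -/
theorem nearestPoint_of_mem_parts (hP : IsCompact P) (hc : Convex ℝ P) (hFP : F ⊆ P) {y : V}
    (h1 : (vectorSpan ℝ F).orthogonalProjectionOnto (y - basePoint F) ∈ directionPart F)
    (h2 : (vectorSpan ℝ F)ᗮ.orthogonalProjectionOnto (y - basePoint F) ∈ normalPart F P) :
    nearestPoint P y =
      basePoint F + (vectorSpan ℝ F).orthogonalProjectionOnto (y - basePoint F) := by
  refine nearestPoint_eq hP hc (hFP h1) fun q hq => ?_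
  rw [basePoint_decomposition]
  exact h2 _ h1 q hq

theorem infDist_of_mem_closedPiece (hP : IsCompact P) (hc : Convex ℝ P) (hFP : F ⊆ P) {y : V}
    (hy : y ∈ closedPiece F P) :
    Metric.infDist y P = 1 := by
  have h := nearestPoint_of_mem_parts hP hc hFP hy.1 hy.2.1
  rw [← (nearestPoint_spec hP ⟨_, hFP hy.1⟩ y).2, h, dist_eq_norm, basePoint_decomposition]
  exact hy.2.2

theorem sub_mem_vectorSpan {p q : V} (hp : p ∈ F) (hq : q ∈ F) : p - q ∈ vectorSpan ℝ F :=
  vsub_mem_vectorSpan ℝ hp hq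

theorem mem_closedPiece_of_add (hFP : F ⊆ P) {p u : V} (hp : p ∈ F) (hu : u ∈ normalCone F P)
    (hu1 : ‖u‖ = 1) : p + u ∈ closedPiece F P := by
  have hb : basePoint F ∈ F := basePoint_mem ⟨p, hp⟩
  have huW := normalCone_subset_orthogonal hFP hu
  have e : p + u - basePoint F =
      ((⟨p - basePoint F, sub_mem_vectorSpan hp hb⟩ : vectorSpan ℝ F) : V) +
        ((⟨u, huW⟩ : (vectorSpan ℝ F)ᗮ) : V) := by
    simp; abel
  refine ⟨?_, ?_, ?_⟩
  · rw [e, proj_add_left]; simpa [directionPart] using hp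
  · rw [e, proj_add_right]; exact hu
  · rw [e, proj_add_right]; exact hu1

end Piece

/-- The required face is the one exposed by `y - p`, where `p` is the point of `P` nearest to `y`.
-/
theorem exists_mem_closedPiece {P : Set V} (hP : IsCompact P) (hc : Convex ℝ P) (hne : P.Nonempty)
    {y : V} (hy : Metric.infDist y P = 1) : ∃ F ∈ allFaces P, y ∈ closedPiece F P := by
  set p := nearestPoint P y with hp
  obtain ⟨hpP, hd⟩ := nearestPoint_spec hP hne y
  have hle := fun q hq => inner_sub_nearestPoint_nonpos hP hc hne y (q := q) hq
  set F := (innerSL ℝ (y - p)).toExposed P with hF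
  have hpF : p ∈ F := ⟨hpP, fun q hq => by
    have := hle q hq
    rw [← hp, inner_sub_right] at this
    simp only [innerSL_apply_apply]
    linarith⟩
  refine ⟨F, ⟨⟨p, hpF⟩, ContinuousLinearMap.toExposed.isExposed⟩, ?_⟩
  have hu : y - p ∈ normalCone F P := by
    intro q hq r hr
    have := hq.2 r hr
    simp only [innerSL_apply_apply] at this
    rw [inner_sub_right]
    linarith
  have := mem_closedPiece_of_add (F := F) (P := P) (fun q hq => hq.1) hpF hu
    (by rw [← dist_eq_norm, hp, hd, hy])
  rwa [add_sub_cancel] at this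

/-- A functional that attains its maximum over `P` at a relatively interior point of `F` is constant
on `F`: from that point one can move slightly away from any `x ∈ F` without leaving `F`. -/
theorem subset_of_openPiece {F G P : Set V} (hFP : F ⊆ P) (hG : IsExposed ℝ P G)
    (a : vectorSpan ℝ F) (ha : a ∈ interior (directionPart F)) (haG : basePoint F + (a : V) ∈ G) :
    F ⊆ G := by
  obtain ⟨l, rfl⟩ := hG ⟨_, haG⟩
  intro x hx
  have haF : basePoint F + (a : V) ∈ F := (interior_subset ha : a ∈ directionPart F)
  set p := basePoint F + (a : V) with hp
  set d : vectorSpan ℝ F := ⟨x - p, sub_mem_vectorSpan hx haF⟩ with hd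
  have hcont : Tendsto (fun t : ℝ => a - t • d) (𝓝[>] 0) (𝓝 a) := by
    have : Continuous fun t : ℝ => a - t • d := by fun_prop
    simpa using (this.tendsto 0).mono_left nhdsWithin_le_nhds
  obtain ⟨t, ht, ht0⟩ := ((hcont.eventually (isOpen_interior.mem_nhds ha)).and
    self_mem_nhdsWithin).exists
  have hmem : basePoint F + ((a - t • d : vectorSpan ℝ F) : V) ∈ F :=
    (interior_subset ht : a - t • d ∈ directionPart F)
  have h1 := haG.2 _ (hFP hmem)
  have e : basePoint F + ((a - t • d : vectorSpan ℝ F) : V) = p - t • (x - p) := by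
    simp [hd, hp]; abel
  rw [e, map_sub, map_smul, map_sub, smul_eq_mul] at h1
  have h2 : l p ≤ l x := by
    have ht0' : 0 < t := ht0
    by_contra hlt
    nlinarith [mul_pos ht0' (sub_pos.2 (not_le.1 hlt))]
  exact ⟨hFP hx, fun q hq => (haG.2 q hq).trans h2⟩

/-- A common point would have its nearest point in the relative interiors of both faces, and each
face would contain the other. -/
theorem openPiece_disjoint {F G P : Set V} (hP : IsCompact P) (hc : Convex ℝ P)
    (hF : F ∈ allFaces P) (hG : G ∈ allFaces P) (h : F ≠ G) :
    Disjoint (openPiece F P) (openPiece G P) := by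
  rw [Set.disjoint_left]
  intro y hyF hyG
  have hyF' := openPiece_subset F P hyF
  have hyG' := openPiece_subset G P hyG
  have eF := nearestPoint_of_mem_parts hP hc hF.2.subset hyF'.1 hyF'.2.1
  have eG := nearestPoint_of_mem_parts hP hc hG.2.subset hyG'.1 hyG'.2.1
  refine h (Set.Subset.antisymm ?_ ?_)
  · refine subset_of_openPiece hF.2.subset hG.2 _ hyF.1 ?_
    rw [← eF, eG]; exact hyG'.1
  · refine subset_of_openPiece hG.2.subset hF.2 _ hyG.1 ?_
    rw [← eG, eF]; exact hyF'.1

/-! ### The derivative of the normal map -/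

theorem hasFDerivAt_normalize {q : V} (hq : ‖q‖ = 1) :
    HasFDerivAt (fun z : V => ‖z‖⁻¹ • z)
      (ContinuousLinearMap.id ℝ V - (innerSL ℝ q).smulRight q) q := by
  have h0 : ‖q‖ ^ 2 ≠ 0 := by rw [hq]; norm_num
  have h1 : HasFDerivAt (fun z : V => ‖z‖) (innerSL ℝ q) q := by
    have := (hasFDerivAt_id (𝕜 := ℝ) q).norm_sq.sqrt h0
    simp only [id_eq, Real.sqrt_sq (norm_nonneg _), hq] at this
    convert this using 1
    ext v; simp
  have h2 := (hasDerivAt_inv (x := ‖q‖) (by rw [hq]; norm_num)).comp_hasFDerivAt q h1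
  refine (h2.smul (hasFDerivAt_id q)).congr_fderiv (ContinuousLinearMap.ext fun v => ?_)
  simp [hq, sub_eq_add_neg]

theorem normalMap_of_mem_parts {F P : Set V} (hP : IsCompact P) (hc : Convex ℝ P) (hFP : F ⊆ P)
    {y : V}
    (h1 : (vectorSpan ℝ F).orthogonalProjectionOnto (y - basePoint F) ∈ directionPart F)
    (h2 : (vectorSpan ℝ F)ᗮ.orthogonalProjectionOnto (y - basePoint F) ∈ normalPart F P) :
    normalMap P y = (basePoint F + (vectorSpan ℝ F).starProjection (y - basePoint F),
      ‖(vectorSpan ℝ F)ᗮ.starProjection (y - basePoint F)‖⁻¹ •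
        (vectorSpan ℝ F)ᗮ.starProjection (y - basePoint F)) := by
  rw [normalMap, nearestPoint_of_mem_parts hP hc hFP h1 h2, basePoint_decomposition]
  rfl

theorem normalMap_snd_of_mem_closedPiece {F P : Set V} (hP : IsCompact P) (hc : Convex ℝ P)
    (hFP : F ⊆ P) {y : V} (hy : y ∈ closedPiece F P) :
    (normalMap P y).2 = (vectorSpan ℝ F)ᗮ.starProjection (y - basePoint F) := by
  have hn : ‖(vectorSpan ℝ F)ᗮ.starProjection (y - basePoint F)‖ = 1 := hy.2.2
  rw [normalMap_of_mem_parts hP hc hFP hy.1 hy.2.1, hn, inv_one, one_smul]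

theorem normalMap_snd_mem {F P : Set V} (hP : IsCompact P) (hc : Convex ℝ P)
    (hFP : F ⊆ P) {y : V} (hy : y ∈ closedPiece F P) :
    (normalMap P y).2 ∈ (vectorSpan ℝ F)ᗮ ∧ ‖(normalMap P y).2‖ = 1 := by
  rw [normalMap_snd_of_mem_closedPiece hP hc hFP hy]
  exact ⟨(vectorSpan ℝ F)ᗮ.starProjection_apply_mem _, hy.2.2⟩

/-- On the open piece over the face `F`, the derivative of the normal map in tangential directions
is given by the projections to the direction of `F` and to its orthogonal complement. -/
theorem fderiv_normalMap {F P : Set V} (hP : IsCompact P) (hc : Convex ℝ P) (hFP : F ⊆ P)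
    {y : V} (hy : y ∈ openPiece F P) {v : V} (hv : inner ℝ (normalMap P y).2 v = 0) :
    fderiv ℝ (normalMap P) y v =
      ((vectorSpan ℝ F).starProjection v, (vectorSpan ℝ F)ᗮ.starProjection v) := by
  rw [normalMap_snd_of_mem_closedPiece hP hc hFP (openPiece_subset F P hy)] at hv
  set W := vectorSpan ℝ F with hW
  set b := basePoint F with hb
  have hev : ∀ᶠ z in 𝓝 y, normalMap P z = (b + W.starProjection (z - b),
      ‖Wᗮ.starProjection (z - b)‖⁻¹ • Wᗮ.starProjection (z - b)) := by
    have hc1 : Continuous fun z : V => W.orthogonalProjectionOnto (z - b) := by fun_prop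
    have hc2 : Continuous fun z : V => Wᗮ.orthogonalProjectionOnto (z - b) := by fun_prop
    filter_upwards [hc1.continuousAt.eventually (isOpen_interior.mem_nhds hy.1),
      hc2.continuousAt.eventually (isOpen_interior.mem_nhds hy.2.1)] with z h1 h2
    exact normalMap_of_mem_parts hP hc hFP (interior_subset h1) (interior_subset h2)
  have hn : ‖Wᗮ.starProjection (y - b)‖ = 1 := hy.2.2
  have hmem := Wᗮ.starProjection_apply_mem (y - b)
  -- Tangent directions have no radial component, so differentiating the normalization contributes
  -- no correction term.
  have hv' : inner ℝ (Wᗮ.starProjection (y - b)) (Wᗮ.starProjection v) = 0 := by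
    rw [← inner_starProjection_left_eq_right, starProjection_eq_self_iff.2 hmem, hv]
  have hd1 : HasFDerivAt (fun z : V => b + W.starProjection (z - b)) W.starProjection y :=
    ((W.starProjection.hasFDerivAt).comp y ((hasFDerivAt_id y).sub_const b)).const_add b
  have hd2 : HasFDerivAt (fun z : V => Wᗮ.starProjection (z - b)) Wᗮ.starProjection y :=
    (Wᗮ.starProjection.hasFDerivAt).comp y ((hasFDerivAt_id y).sub_const b)
  have hd3 := (hasFDerivAt_normalize hn).comp y hd2
  have hd := (hd1.prodMk hd3).congr_of_eventuallyEq hev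
  rw [hd.fderiv]
  simp only [ContinuousLinearMap.prod_apply, ContinuousLinearMap.comp_apply,
    sub_apply, ContinuousLinearMap.id_apply,
    ContinuousLinearMap.smulRight_apply, innerSL_apply_apply, hv', zero_smul, sub_zero]

end Polytope

/-! ### Measures of the pieces of the parallel hypersurface -/

section Pieces

open MeasureTheory Filter Topology Submodule

set_option linter.unusedSectionVars false

variable {V : Type*} [NormedAddCommGroup V] [InnerProductSpace ℝ V] [FiniteDimensional ℝ V]
  [MeasurableSpace V] [BorelSpace V]

/-- The normalizing factor of the `k`-dimensional Hausdorff measure. -/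
def hausdorffFactor (k : ℕ) : ENNReal :=
  (μH[(k : ℝ)] {x : EuclideanSpace ℝ (Fin k) | ∀ i, x i ∈ Set.Icc (0 : ℝ) 1})⁻¹

theorem hausdorff_apply (k : ℕ) (S : Set V) :
    hausdorff k S = hausdorffFactor k * μH[(k : ℝ)] S := rfl

theorem isAddHaarMeasure_hausdorff_euclidean (k : ℕ) :
    (μH[(k : ℝ)] : Measure (EuclideanSpace ℝ (Fin k))).IsAddHaarMeasure := by
  simpa using isAddHaarMeasure_hausdorffMeasure (E := EuclideanSpace ℝ (Fin k))

theorem unitCube_eq (k : ℕ) :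
    {x : EuclideanSpace ℝ (Fin k) | ∀ i, x i ∈ Set.Icc (0 : ℝ) 1} =
      (EuclideanSpace.equiv (Fin k) ℝ) ⁻¹' (Set.univ.pi fun _ => Set.Icc 0 1) := by
  ext x
  exact ⟨fun h i _ => h i, fun h i => h i (Set.mem_univ i)⟩

theorem hausdorffFactor_ne_top (k : ℕ) : hausdorffFactor k ≠ ⊤ := by
  have := isAddHaarMeasure_hausdorff_euclidean k
  rw [hausdorffFactor, ENNReal.inv_ne_top, unitCube_eq]
  have hopen : IsOpen ((EuclideanSpace.equiv (Fin k) ℝ) ⁻¹'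
      (Set.univ.pi fun _ : Fin k => Set.Ioo (0 : ℝ) 1)) :=
    (isOpen_set_pi Set.finite_univ fun _ _ => isOpen_Ioo).preimage
      (EuclideanSpace.equiv (Fin k) ℝ).continuous
  have hne : ((EuclideanSpace.equiv (Fin k) ℝ) ⁻¹'
      (Set.univ.pi fun _ : Fin k => Set.Ioo (0 : ℝ) 1)).Nonempty :=
    ⟨(EuclideanSpace.equiv (Fin k) ℝ).symm fun _ => 1 / 2, by
      simp only [Set.mem_preimage, ContinuousLinearEquiv.apply_symm_apply]
      intro i _
      norm_num⟩
  refine ((hopen.measure_pos μH[(k : ℝ)] hne).trans_le (measure_mono ?_)).ne'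
  exact Set.preimage_mono (Set.pi_mono fun _ _ => Set.Ioo_subset_Icc_self)

theorem hausdorffFactor_ne_zero (k : ℕ) : hausdorffFactor k ≠ 0 := by
  have := isAddHaarMeasure_hausdorff_euclidean k
  rw [hausdorffFactor, ENNReal.inv_ne_zero, unitCube_eq]
  refine (IsCompact.measure_lt_top ?_).ne
  exact (EuclideanSpace.equiv (Fin k) ℝ).toHomeomorph.isCompact_preimage.2
    (isCompact_univ_pi fun _ => isCompact_Icc)

theorem exists_hausdorffMeasure_eq_smul_volume (G : Type*) [NormedAddCommGroup G]
    [InnerProductSpace ℝ G] [FiniteDimensional ℝ G] [MeasurableSpace G] [BorelSpace G] :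
    ∃ c : ENNReal, c ≠ 0 ∧ c ≠ ⊤ ∧
      (μH[(Module.finrank ℝ G : ℝ)] : Measure G) = c • (volume : Measure G) := by
  refine ⟨_, ?_, ENNReal.coe_ne_top,
    Measure.isAddLeftInvariant_eq_smul (μH[(Module.finrank ℝ G : ℝ)] : Measure G) volume⟩
  exact ENNReal.coe_ne_zero.2 (ne_of_gt (Measure.addHaarScalarFactor_pos_of_isAddHaarMeasure _ _))

/-- The normalized Hausdorff measure on a subspace is a multiple of the volume. -/
theorem exists_hausdorff_coe_eq (U : Submodule ℝ V) :
    ∃ c : ENNReal, c ≠ 0 ∧ c ≠ ⊤ ∧ ∀ A : Set U,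
      hausdorff (Module.finrank ℝ U) ((↑) '' A : Set V) = c * volume A := by
  obtain ⟨c, h0, ht, h⟩ := exists_hausdorffMeasure_eq_smul_volume U
  refine ⟨hausdorffFactor (Module.finrank ℝ U) * c, mul_ne_zero (hausdorffFactor_ne_zero _) h0,
    ENNReal.mul_ne_top (hausdorffFactor_ne_top _) ht, fun A => ?_⟩
  rw [hausdorff_apply, isometry_subtype_coe.hausdorffMeasure_image (Or.inl (Nat.cast_nonneg _)), h,
    Measure.smul_apply, smul_eq_mul, mul_assoc]

/-- The normalization of Hausdorff measure cancels in the quotient, so that volumes in `(vectorSpan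
ℝ F)ᗮ` may be used. -/
theorem exteriorAngle_eq {F P : Set V} (hFP : F ⊆ P) :
    exteriorAngle F P = (volume (normalPart F P ∩ Metric.closedBall 0 1)).toReal /
      (volume (Metric.closedBall (0 : (vectorSpan ℝ F)ᗮ) 1)).toReal := by
  obtain ⟨c, h0, ht, h⟩ := exists_hausdorff_coe_eq (vectorSpan ℝ F)ᗮ
  have e1 : normalCone F P ∩ Metric.closedBall (0 : V) 1 =
      (↑) '' (normalPart F P ∩ Metric.closedBall 0 1) := by
    ext w
    constructor
    · rintro ⟨h1, h2⟩
      exact ⟨⟨w, normalCone_subset_orthogonal hFP h1⟩, ⟨h1, by simpa using h2⟩, rfl⟩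
    · rintro ⟨w, ⟨h1, h2⟩, rfl⟩
      exact ⟨h1, by simpa using h2⟩
  have e2 : ((vectorSpan ℝ F)ᗮ : Set V) ∩ Metric.closedBall (0 : V) 1 =
      (↑) '' (Metric.closedBall (0 : (vectorSpan ℝ F)ᗮ) 1) := by
    ext w
    constructor
    · rintro ⟨h1, h2⟩
      exact ⟨⟨w, h1⟩, by simpa using h2, rfl⟩
    · rintro ⟨w, h2, rfl⟩
      exact ⟨w.2, by simpa using h2⟩
  simp only [exteriorAngle]
  rw [e1, e2, h, h, ENNReal.toReal_mul, ENNReal.toReal_mul,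
    mul_div_mul_left _ _ (ENNReal.toReal_ne_zero.2 ⟨h0, ht⟩)]

/-- The factor is chosen before `F`, so it depends on the direction alone; this is what later makes
the coefficient a function of the subspace. -/
theorem exists_hausdorff_face_eq (U : Submodule ℝ V) :
    ∃ c : ENNReal, c ≠ 0 ∧ c ≠ ⊤ ∧ ∀ (F E : Set V), F.Nonempty → vectorSpan ℝ F = U →
      hausdorff (Module.finrank ℝ U) (F ∩ E) =
        c * volume (directionPart F ∩ {a | basePoint F + (a : V) ∈ E}) := by
  obtain ⟨c, h0, ht, h⟩ := exists_hausdorff_coe_eq U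
  refine ⟨c, h0, ht, ?_⟩
  rintro F E hF rfl
  rw [← h, hausdorff_apply, hausdorff_apply,
    ← (IsometryEquiv.addLeft (basePoint F)).hausdorffMeasure_image _ (Subtype.val '' _)]
  congr 2
  ext x
  simp only [Set.mem_image, IsometryEquiv.addLeft_apply, exists_exists_and_eq_and]
  constructor
  · rintro ⟨hx, hxE⟩
    exact ⟨⟨x - basePoint F, sub_mem_vectorSpan hx (basePoint_mem hF)⟩,
      ⟨by simpa [directionPart] using hx, by simpa using hxE⟩, by simp⟩
  · rintro ⟨a, ⟨h1, h2⟩, rfl⟩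
    exact ⟨h1, h2⟩

/-- The measure of the parts of the parallel hypersurface that lie over a face with
direction `U`. -/
theorem exists_hausdorff_facePiece_eq {m : ℕ} (hdim : Module.finrank ℝ V = m + 1)
    (U : Submodule ℝ V) :
    ∃ c : ENNReal, c ≠ ⊤ ∧ ∀ (F : Set V) (A : Set (vectorSpan ℝ F)) (N : Set (vectorSpan ℝ F)ᗮ),
      vectorSpan ℝ F = U → MeasurableSet A → MeasurableSet N →
      (∀ t : ℝ, 0 < t → ∀ w ∈ N, t • w ∈ N) →
      hausdorff m (facePiece F A N) = c * (volume A * volume (N ∩ Metric.closedBall 0 1)) := by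
  -- A full-dimensional face has no unit normals: the piece is empty and the factor may be `0`.
  rcases eq_or_ne U ⊤ with hU | hU
  · refine ⟨0, by simp, ?_⟩
    rintro F A N hF - - -
    rw [hU] at hF
    have : facePiece F A N = ∅ := by
      refine Set.eq_empty_of_forall_notMem fun y hy => ?_
      have h1 := hy.2.2
      set w := (vectorSpan ℝ F)ᗮ.orthogonalProjectionOnto (y - basePoint F) with hw
      have h2 : (w : V) ∈ (⊤ : Submodule ℝ V)ᗮ := hF ▸ w.2
      rw [top_orthogonal_eq_bot, Submodule.mem_bot] at h2
      have h3 : ‖(w : V)‖ = 1 := h1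
      rw [h2] at h3; simp at h3
    rw [this, measure_empty, zero_mul]
  · obtain ⟨c, hc, h⟩ := exists_hausdorff_cylinder_eq U hdim hU
    refine ⟨hausdorffFactor m * c, ENNReal.mul_ne_top (hausdorffFactor_ne_top _) hc, ?_⟩
    rintro F A N rfl hA hN hcone
    rw [hausdorff_apply, mul_assoc, ← h A N hA hN hcone,
      ← (IsometryEquiv.subRight (basePoint F)).hausdorffMeasure_preimage _ {y | _}]
    rfl

/-! ### Closedness, convexity and null boundaries -/

section Parts

variable {F P : Set V}

theorem isClosed_directionPart (hF : IsClosed F) : IsClosed (directionPart F) :=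
  hF.preimage (by fun_prop : Continuous fun a : vectorSpan ℝ F => basePoint F + (a : V))

theorem convex_directionPart (hF : Convex ℝ F) : Convex ℝ (directionPart F) := by
  intro a ha b hb s t hs ht hst
  have := hF ha hb hs ht hst
  have e : s • (basePoint F + (a : V)) + t • (basePoint F + (b : V)) =
      basePoint F + ((s • a + t • b : vectorSpan ℝ F) : V) := by
    rw [smul_add, smul_add, add_add_add_comm, ← add_smul, hst, one_smul]; rfl
  rw [e] at this
  exact this

theorem isClosed_normalPart : IsClosed (normalPart F P) :=
  (isClosed_normalCone F P).preimage continuous_subtype_val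

theorem convex_normalPart : Convex ℝ (normalPart F P) :=
  (convex_normalCone F P).linear_preimage (vectorSpan ℝ F)ᗮ.subtype

theorem smul_mem_normalPart {t : ℝ} (ht : 0 < t) {w : (vectorSpan ℝ F)ᗮ}
    (hw : w ∈ normalPart F P) : t • w ∈ normalPart F P :=
  smul_mem_normalCone hw ht.le

/-- Dilations are homeomorphisms preserving the cone. Thus the frontier is a cone as well, and the
product formula for pieces applies to it. -/
theorem smul_mem_frontier_normalPart {t : ℝ} (ht : 0 < t) {w : (vectorSpan ℝ F)ᗮ}
    (hw : w ∈ frontier (normalPart F P)) : t • w ∈ frontier (normalPart F P) := by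
  have h := (Homeomorph.smulOfNeZero t ht.ne' (α := (vectorSpan ℝ F)ᗮ)).preimage_frontier
    (normalPart F P)
  have e : (Homeomorph.smulOfNeZero t ht.ne' (α := (vectorSpan ℝ F)ᗮ)) ⁻¹' (normalPart F P) =
      normalPart F P := by
    ext v
    simp only [Set.mem_preimage, Homeomorph.smulOfNeZero_apply]
    refine ⟨fun hv => ?_, smul_mem_normalPart ht⟩
    have := smul_mem_normalPart (inv_pos.2 ht) hv
    rwa [smul_smul, inv_mul_cancel₀ ht.ne', one_smul] at this
  rw [e] at h
  rw [← h] at hw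
  exact hw

theorem volume_normalPart_inter_ne_top : volume (normalPart F P ∩ Metric.closedBall 0 1) ≠ ⊤ :=
  ((measure_mono Set.inter_subset_right).trans_lt (isCompact_closedBall _ _).measure_lt_top).ne

theorem hausdorff_closedPiece_ne_top {m : ℕ} (hdim : Module.finrank ℝ V = m + 1)
    (hF : IsCompact F) : hausdorff m (closedPiece F P) ≠ ⊤ := by
  obtain ⟨c, hc, h⟩ := exists_hausdorff_facePiece_eq hdim (vectorSpan ℝ F)
  rw [h F _ _ rfl (isClosed_directionPart hF.isClosed).measurableSet
    isClosed_normalPart.measurableSet fun t ht w => smul_mem_normalPart ht]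
  refine ENNReal.mul_ne_top hc (ENNReal.mul_ne_top ?_ volume_normalPart_inter_ne_top)
  have hcl : Topology.IsClosedEmbedding fun a : vectorSpan ℝ F => basePoint F + (a : V) :=
    (Homeomorph.addLeft (basePoint F)).isClosedEmbedding.comp
      (vectorSpan ℝ F).closed_of_finiteDimensional.isClosedEmbedding_subtypeVal
  exact (hcl.isCompact_preimage hF).measure_lt_top.ne

/-- The boundary of a convex set is null, in `W` as well as in `Wᗮ`, and the product formula
transfers this to the piece. The interiors need not be known to be nonempty. -/
theorem hausdorff_closedPiece_diff {m : ℕ} (hdim : Module.finrank ℝ V = m + 1)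
    (hF : Convex ℝ F) : hausdorff m (closedPiece F P \ openPiece F P) = 0 := by
  obtain ⟨c, hc, h⟩ := exists_hausdorff_facePiece_eq hdim (vectorSpan ℝ F)
  have h1 : hausdorff m (facePiece F (frontier (directionPart F)) Set.univ) = 0 := by
    rw [h F _ _ rfl isClosed_frontier.measurableSet MeasurableSet.univ (by simp),
      (convex_directionPart hF).addHaar_frontier volume, zero_mul, mul_zero]
  have h2 : hausdorff m (facePiece F Set.univ (frontier (normalPart F P))) = 0 := by
    have h3 : volume (frontier (normalPart F P)) = 0 :=
      (convex_normalPart (F := F) (P := P)).addHaar_frontier volume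
    replace h3 : volume (frontier (normalPart F P) ∩ Metric.closedBall 0 1) = 0 :=
      measure_mono_null Set.inter_subset_left h3
    rw [h F _ _ rfl MeasurableSet.univ isClosed_frontier.measurableSet
      fun t ht w hw => smul_mem_frontier_normalPart ht hw, h3, mul_zero, mul_zero]
  refine measure_mono_null ?_ (measure_union_null h1 h2)
  rintro y ⟨hy, hy'⟩
  by_cases h3 : (vectorSpan ℝ F).orthogonalProjectionOnto (y - basePoint F) ∈
      interior (directionPart F)
  · refine Or.inr ⟨Set.mem_univ _, ⟨subset_closure hy.2.1, fun h4 => hy' ⟨h3, h4, hy.2.2⟩⟩, hy.2.2⟩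
  · exact Or.inl ⟨⟨subset_closure hy.1, h3⟩, Set.mem_univ _, hy.2.2⟩

theorem measurableSet_facePiece {A : Set (vectorSpan ℝ F)} {N : Set (vectorSpan ℝ F)ᗮ}
    (hA : MeasurableSet A) (hN : MeasurableSet N) : MeasurableSet (facePiece F A N) := by
  have h1 : Measurable fun y : V =>
      (vectorSpan ℝ F).orthogonalProjectionOnto (y - basePoint F) :=
    Continuous.measurable (by fun_prop)
  have h2 : Measurable fun y : V =>
      (vectorSpan ℝ F)ᗮ.orthogonalProjectionOnto (y - basePoint F) :=
    Continuous.measurable (by fun_prop)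
  exact (h1 hA).inter ((h2 hN).inter (h2.norm (measurableSet_singleton 1)))

end Parts

/-- The measure of the part of the parallel hypersurface that lies over a face is a multiple of the
product of the exterior angle and the measure of the face; the factor depends only on the direction
of the face. -/
theorem exists_hausdorff_closedPiece_eq {m : ℕ} (hdim : Module.finrank ℝ V = m + 1) :
    ∃ κ : Submodule ℝ V → ℝ, ∀ P : Set V, IsCompact P → Convex ℝ P → ∀ F ∈ allFaces P,
      ∀ E : Set V, MeasurableSet E →
      (hausdorff m (closedPiece F P ∩ {y | nearestPoint P y ∈ E})).toReal =
        κ (vectorSpan ℝ F) * exteriorAngle F P *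
          (hausdorff (Module.finrank ℝ (vectorSpan ℝ F)) (F ∩ E)).toReal := by
  choose c hc h using exists_hausdorff_facePiece_eq (V := V) hdim
  choose d hd0 hd hd' using exists_hausdorff_face_eq (V := V)
  -- The factor of the product formula, multiplied by the denominator of the exterior angle and
  -- divided by the factor relating Hausdorff measure on the face to volume on `U`.
  refine ⟨fun U => (c U).toReal * (volume (Metric.closedBall (0 : Uᗮ) 1)).toReal / (d U).toReal,
    fun P hP hc' F hF E hE => ?_⟩
  have hFP : F ⊆ P := hF.2.subset
  have hcl : IsClosed F := (hF.2.isCompact hP).isClosed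
  -- The nearest point depends on the `W`-coordinate only, so restricting it to `E` preserves the
  -- product structure.
  have e : closedPiece F P ∩ {y | nearestPoint P y ∈ E} =
      facePiece F (directionPart F ∩ {a | basePoint F + (a : V) ∈ E}) (normalPart F P) := by
    ext y
    constructor
    · rintro ⟨⟨h1, h2, h3⟩, h4⟩
      rw [Set.mem_ofPred_eq, nearestPoint_of_mem_parts hP hc' hFP h1 h2] at h4
      exact ⟨⟨h1, h4⟩, h2, h3⟩
    · rintro ⟨⟨h1, h4⟩, h2, h3⟩
      refine ⟨⟨h1, h2, h3⟩, ?_⟩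
      rw [Set.mem_ofPred_eq, nearestPoint_of_mem_parts hP hc' hFP h1 h2]
      exact h4
  have hm : MeasurableSet {a : vectorSpan ℝ F | basePoint F + (a : V) ∈ E} :=
    (by fun_prop : Continuous fun a : vectorSpan ℝ F => basePoint F + (a : V)).measurable hE
  rw [e, h _ F _ _ rfl ((isClosed_directionPart hcl).measurableSet.inter hm)
    isClosed_normalPart.measurableSet fun t ht w => smul_mem_normalPart ht,
    hd' _ F E hF.1 rfl, exteriorAngle_eq hFP]
  simp only [ENNReal.toReal_mul]
  have h1 : (d (vectorSpan ℝ F)).toReal ≠ 0 := ENNReal.toReal_ne_zero.2 ⟨hd0 _, hd _⟩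
  have h2 : (volume (Metric.closedBall (0 : (vectorSpan ℝ F)ᗮ) 1)).toReal ≠ 0 :=
    ENNReal.toReal_ne_zero.2 ⟨(Metric.measure_closedBall_pos _ _ one_pos).ne',
      (isCompact_closedBall _ _).measure_lt_top.ne⟩
  field_simp

end Pieces

/-! ### A criterion for angularity -/

section Criterion

open MeasureTheory Filter Topology Submodule

set_option linter.unusedSectionVars false

variable {V : Type*} [NormedAddCommGroup V] [InnerProductSpace ℝ V] [FiniteDimensional ℝ V]
  [MeasurableSpace V] [BorelSpace V] {m : ℕ}

theorem adaptedFrameValue_congr (o : Orientation ℝ V (Fin (m + 1))) {u : V} {A : Type*}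
    [AddCommGroup A] [Module ℝ A] {S T : OrthonormalBasis (Fin (m + 1)) ℝ V → A}
    (h : ∀ b : OrthonormalBasis (Fin (m + 1)) ℝ V, b 0 = u → S b = T b) :
    adaptedFrameValue o u S = adaptedFrameValue o u T := by
  unfold adaptedFrameValue
  split_ifs with hb
  · rw [h _ hb.choose_spec]
  · rfl

/-- The values of the form `ψ` on the normal cycle of a polytope, at a normal vector `u` along a
face with direction `W`. -/
def faceValue (o : Orientation ℝ V (Fin (m + 1))) (ψ : V → (V × V) [⋀^Fin m]→ₗ[ℝ] ℝ)
    (W : Submodule ℝ V) (u : V) : ℝ :=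
  adaptedFrameValue o u fun b =>
    ψ u fun i : Fin m => (W.starProjection (b i.succ), Wᗮ.starProjection (b i.succ))

/-- Up to null sets the hypersurface is the disjoint union of the open pieces, and on each of them
the integrand is the constant `c (vectorSpan ℝ F)`. -/
theorem integralNormalCycle_eq (hdim : Module.finrank ℝ V = m + 1)
    (o : Orientation ℝ V (Fin (m + 1))) (ψ : V → (V × V) [⋀^Fin m]→ₗ[ℝ] ℝ)
    (c : Submodule ℝ V → ℝ)
    (hψ : ∀ (W : Submodule ℝ V) (u : V), u ∈ Wᗮ → ‖u‖ = 1 → faceValue o ψ W u = c W)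
    (s : Finset V) (hs : s.Nonempty) {E : Set V} (hE : MeasurableSet E) :
    integralNormalCycle o ψ (convexHull ℝ (s : Set V)) E =
      ∑ F ∈ (finite_allFaces s).toFinset, c (vectorSpan ℝ F) *
        (hausdorff m (closedPiece F (convexHull ℝ (s : Set V)) ∩
          {y | nearestPoint (convexHull ℝ (s : Set V)) y ∈ E})).toReal := by
  set P := convexHull ℝ (s : Set V) with hPdef
  have hP : IsCompact P := s.finite_toSet.isCompact_convexHull ℝ
  have hc : Convex ℝ P := convex_convexHull ℝ _
  have hne : P.Nonempty := by simpa [hPdef] using hs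
  set S : Set V := {y | nearestPoint P y ∈ E} with hS
  have hSm : MeasurableSet S := (continuous_nearestPoint hP hc hne).measurable hE
  set Φ := (finite_allFaces s).toFinset with hΦ
  have hmem : ∀ {F}, F ∈ Φ ↔ F ∈ allFaces P := by simp [hΦ, hPdef]
  have hnull : hausdorff m (⋃ F ∈ Φ, closedPiece F P \ openPiece F P) = 0 :=
    (measure_biUnion_null_iff Φ.countable_toSet).2 fun F hF =>
      hausdorff_closedPiece_diff hdim ((hmem.1 hF).2.convex hc)
  have hdomain : ({y | Metric.infDist y P = 1 ∧ (normalMap P y).1 ∈ E} : Set V) =ᵐ[hausdorff m]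
      ⋃ F ∈ Φ, openPiece F P ∩ S := by
    rw [ae_eq_set]
    constructor
    · refine measure_mono_null ?_ hnull
      rintro y ⟨⟨hy1, hy2⟩, hy3⟩
      obtain ⟨F, hF, hyF⟩ := exists_mem_closedPiece hP hc hne hy1
      refine Set.mem_biUnion (hmem.2 hF) ⟨hyF, fun hy4 => hy3 ?_⟩
      exact Set.mem_biUnion (hmem.2 hF) ⟨hy4, hy2⟩
    · convert measure_empty (μ := hausdorff (V := V) m)
      refine Set.sdiff_eq_empty.2 (Set.iUnion₂_subset fun F hF y hy => ?_)
      exact ⟨infDist_of_mem_closedPiece hP hc (hmem.1 hF).2.subset (openPiece_subset F P hy.1),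
        hy.2⟩
  have hopen : ∀ F ∈ Φ, MeasurableSet (openPiece F P ∩ S) := fun F _ =>
    (measurableSet_facePiece isOpen_interior.measurableSet isOpen_interior.measurableSet).inter hSm
  have hval : ∀ F ∈ Φ, Set.EqOn (fun y => adaptedFrameValue o (normalMap P y).2 (fun b =>
      ψ (normalMap P y).2 (fun i : Fin m => fderiv ℝ (normalMap P) y (b i.succ))))
      (fun _ => c (vectorSpan ℝ F)) (openPiece F P ∩ S) := by
    intro F hF y hy
    have hFP := (hmem.1 hF).2.subset
    obtain ⟨h1, h2⟩ := normalMap_snd_mem hP hc hFP (openPiece_subset F P hy.1)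
    simp only
    rw [← hψ _ _ h1 h2]
    refine adaptedFrameValue_congr o fun b hb => ?_
    congr 1
    funext i
    -- The frame is adapted to the normal `b 0`, so the remaining frame vectors are tangent to the
    -- hypersurface.
    refine fderiv_normalMap hP hc hFP hy.1 ?_
    rw [← hb]
    exact b.orthonormal.2 (Fin.succ_ne_zero i).symm
  have hfin : ∀ F ∈ Φ, hausdorff m (openPiece F P ∩ S) < ⊤ := fun F hF =>
    (measure_mono (Set.inter_subset_left.trans (openPiece_subset F P))).trans_lt
      (hausdorff_closedPiece_ne_top hdim ((hmem.1 hF).2.isCompact hP)).lt_top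
  have hae : ∀ F ∈ Φ,
      (openPiece F P ∩ S : Set V) =ᵐ[hausdorff m] (closedPiece F P ∩ S : Set V) := by
    intro F hF
    refine ae_eq_set.2 ⟨?_, ?_⟩
    · refine measure_mono_null (t := ∅) ?_ measure_empty
      rintro y ⟨hy, hy'⟩
      exact hy' ⟨openPiece_subset F P hy.1, hy.2⟩
    · refine measure_mono_null ?_ (hausdorff_closedPiece_diff (P := P) hdim
        ((hmem.1 hF).2.convex hc))
      rintro y ⟨hy, hy'⟩
      exact ⟨hy.1, fun h => hy' ⟨h, hy.2⟩⟩
  rw [integralNormalCycle, setIntegral_congr_set hdomain, integral_biUnion_finset Φ hopen]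
  · refine Finset.sum_congr rfl fun F hF => ?_
    rw [setIntegral_congr_fun (hopen F hF) (hval F hF), setIntegral_const, smul_eq_mul, mul_comm,
      Measure.real, measure_congr (hae F hF)]
  · intro F hF G hG hFG
    exact (openPiece_disjoint hP hc (hmem.1 hF) (hmem.1 hG) hFG).mono Set.inter_subset_left
      Set.inter_subset_left
  · intro F hF
    rw [integrableOn_congr_fun (hval F hF) (hopen F hF)]
    exact integrableOn_const (hfin F hF).ne

theorem sum_faces_eq (s : Finset V) (f : ℕ → Set V → ℝ) :
    ∑ k ∈ Finset.range (Module.finrank ℝ V + 1),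
      ∑ᶠ F ∈ faces (convexHull ℝ (s : Set V)) k, f k F =
    ∑ F ∈ (finite_allFaces s).toFinset, f (Module.finrank ℝ (vectorSpan ℝ F)) F := by
  classical
  rw [← Finset.sum_fiberwise_of_maps_to (t := Finset.range (Module.finrank ℝ V + 1))
    (g := fun F => Module.finrank ℝ (vectorSpan ℝ F))
    (fun F _ => Finset.mem_range.2 (Nat.lt_succ_of_le (Submodule.finrank_le _)))]
  refine Finset.sum_congr rfl fun k _ => ?_
  rw [← finsum_mem_coe_finset]
  refine finsum_mem_congr ?_ ?_
  · ext F
    simp [faces, allFaces, and_assoc]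
  · intro F hF
    simp only [Finset.coe_filter, Set.mem_ofPred_eq] at hF
    rw [hF.2]

/-- A translation-invariant curvature measure without volume part is angular if the value of its
form on the normal cycles of polytopes depends only on the directions of the faces. -/
theorem isAngular_of_faceValue (hdim : Module.finrank ℝ V = m + 1)
    (o : Orientation ℝ V (Fin (m + 1))) (Ψ : InvFormPair V m) (hvol : Ψ.volForm = 0)
    (c : Submodule ℝ V → ℝ)
    (hψ : ∀ (W : Submodule ℝ V) (u : V), u ∈ Wᗮ → ‖u‖ = 1 → faceValue o Ψ.sphereForm W u = c W) :
    Ψ.IsAngular o := by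
  obtain ⟨κ, hκ⟩ := exists_hausdorff_closedPiece_eq (V := V) hdim
  refine ⟨fun W => c W * κ W, fun s hs E hE => ?_⟩
  have h0 : frameValue o (fun b => Ψ.volForm b) = 0 := by
    simp [frameValue, hvol]
  rw [InvFormPair.curvature, h0, integralNormalCycle_eq hdim o _ c hψ s hs hE, integral_zero,
    add_zero, sum_faces_eq s fun k F => c (vectorSpan ℝ F) * κ (vectorSpan ℝ F) *
      exteriorAngle F (convexHull ℝ (s : Set V)) * (hausdorff k (F ∩ E)).toReal]
  refine Finset.sum_congr rfl fun F hF => ?_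
  rw [hκ _ (s.finite_toSet.isCompact_convexHull ℝ) (convex_convexHull ℝ _) F
    ((finite_allFaces s).mem_toFinset.1 hF) E hE]
  ring

/-- A translation-invariant curvature measure without part on the sphere bundle is angular. -/
theorem isAngular_of_sphereForm_eq_zero (o : Orientation ℝ V (Fin (m + 1)))
    (Ψ : InvFormPair V m) (hψ : ∀ u, Ψ.sphereForm u = 0) : Ψ.IsAngular o := by
  classical
  obtain ⟨κ, hκ0, hκ, h⟩ := exists_hausdorffMeasure_eq_smul_volume V
  set C := hausdorffFactor (Module.finrank ℝ V) * κ with hC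
  have hC0 : C.toReal ≠ 0 := ENNReal.toReal_ne_zero.2
    ⟨mul_ne_zero (hausdorffFactor_ne_zero _) hκ0, ENNReal.mul_ne_top (hausdorffFactor_ne_top _) hκ⟩
  set a := frameValue o fun b => Ψ.volForm b with ha
  -- Only full-dimensional faces carry volume; the constant `C` converts volume into normalized
  -- Hausdorff measure.
  refine ⟨fun W => if W = ⊤ then a / C.toReal else 0, fun s hs E hE => ?_⟩
  set P := convexHull ℝ (s : Set V) with hPdef
  have hP : IsCompact P := s.finite_toSet.isCompact_convexHull ℝ
  have hc : Convex ℝ P := convex_convexHull ℝ _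
  have hne : P.Nonempty := by simpa [hPdef] using hs
  have h0 : integralNormalCycle o Ψ.sphereForm P E = 0 := by
    simp [integralNormalCycle, hψ, adaptedFrameValue]
  rw [InvFormPair.curvature, h0, zero_add, setIntegral_const, smul_eq_mul, Measure.real,
    sum_faces_eq s fun k F => (if vectorSpan ℝ F = ⊤ then a / C.toReal else 0) *
      exteriorAngle F P * (hausdorff k (F ∩ E)).toReal]
  -- A functional exposing `F` is constant on `F`. If `F` spans `V` in direction, the functional
  -- vanishes and `F = P`.
  have htop : ∀ F ∈ (finite_allFaces s).toFinset, F ≠ P →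
      (if vectorSpan ℝ F = ⊤ then a / C.toReal else 0) *
      exteriorAngle F P * (hausdorff (Module.finrank ℝ (vectorSpan ℝ F)) (F ∩ E)).toReal = 0 := by
    intro F hF hFP
    have hF' := (finite_allFaces s).mem_toFinset.1 hF
    rw [if_neg, zero_mul, zero_mul]
    intro hspan
    apply hFP
    obtain ⟨l, hl⟩ := hF'.2 hF'.1
    obtain ⟨p, hp⟩ := hF'.1
    have hconst : ∀ q ∈ F, l q = l p := by
      intro q hq
      rw [hl] at hp hq
      exact le_antisymm (hp.2 q hq.1) (hq.2 p hp.1)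
    have hl0 : ∀ v ∈ vectorSpan ℝ F, l v = 0 := by
      intro v hv
      rw [vectorSpan_def] at hv
      induction hv using Submodule.span_induction with
      | mem x hx =>
        obtain ⟨q, hq, r, hr, rfl⟩ := hx
        change l (q - r) = 0
        rw [map_sub, hconst q hq, hconst r hr, sub_self]
      | zero => simp
      | add x y _ _ hx hy => rw [map_add, hx, hy, add_zero]
      | smul c x _ hx => rw [map_smul, hx, smul_zero]
    have hl0' : ∀ v, l v = 0 := fun v => hl0 v (hspan ▸ mem_top)
    rw [hl]
    ext x
    exact ⟨fun hx => hx.1, fun hx => ⟨hx, fun y _ => by rw [hl0', hl0']⟩⟩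
  rw [Finset.sum_eq_single P htop]
  · by_cases hspan : vectorSpan ℝ P = ⊤
    · have hangle : exteriorAngle P P = 1 := by
        have hbot : (vectorSpan ℝ P)ᗮ = ⊥ := by rw [hspan, top_orthogonal_eq_bot]
        have : Metric.closedBall (0 : (vectorSpan ℝ P)ᗮ) 1 ⊆ normalPart P P := by
          intro w _
          have hw : (w : V) = 0 := by
            have hw : (w : V) ∈ (⊥ : Submodule ℝ V) := hbot.le w.2
            simpa using hw
          change (w : V) ∈ normalCone P P
          intro p _ q _
          rw [hw, inner_zero_left]
        rw [exteriorAngle_eq subset_rfl, Set.inter_eq_right.2 this, div_self]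
        exact ENNReal.toReal_ne_zero.2 ⟨(Metric.measure_closedBall_pos _ _ one_pos).ne',
          (isCompact_closedBall _ _).measure_lt_top.ne⟩
      rw [if_pos hspan, hangle, hspan, finrank_top, hausdorff_apply, h, Measure.smul_apply,
        smul_eq_mul, ← mul_assoc, ← hC, ENNReal.toReal_mul (a := C), ← ha]
      clear_value C
      field_simp
    · rw [if_neg hspan, zero_mul, zero_mul]
      -- If `P` is not full-dimensional, it lies in a proper affine subspace and both sides vanish.
      have : volume P = 0 := by
        have hspan' : affineSpan ℝ P ≠ ⊤ := fun h' => hspan (by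
          rw [← direction_affineSpan, h', AffineSubspace.direction_top])
        exact measure_mono_null (subset_affineSpan ℝ P)
          (Measure.addHaar_affineSubspace volume _ hspan')
      rw [measure_mono_null Set.inter_subset_left this]
      simp
  · intro hP'
    exact absurd ((finite_allFaces s).mem_toFinset.2 ⟨hne, IsExposed.refl P⟩) hP'

end Criterion

/-! ### The value of the forms `φ_{kp}` along a face -/

section FaceForms

open Submodule

variable {V : Type*} [NormedAddCommGroup V] [InnerProductSpace ℝ V] {m : ℕ}

theorem alternating_sum_apply {U ι κ : Type*} [AddCommGroup U] [Module ℝ U] (s : Finset κ)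
    (f : κ → U [⋀^ι]→ₗ[ℝ] ℝ) (v : ι → U) : (∑ i ∈ s, f i) v = ∑ i ∈ s, f i v := by
  classical
  induction s using Finset.induction_on with
  | empty => rfl
  | insert i s hi h => rw [Finset.sum_insert hi, Finset.sum_insert hi, AlternatingMap.add_apply, h]

theorem alternatization_tensorProd_apply {U : Type*} [AddCommGroup U] [Module ℝ U] {q p : ℕ}
    (h : 2 * p ≤ q) (A : Fin p → U →ₗ[ℝ] U →ₗ[ℝ] ℝ) (a : Fin q → U →ₗ[ℝ] ℝ) (v : Fin q → U) :
    MultilinearMap.alternatization (tensorProd h A a) v =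
      ∑ σ : Equiv.Perm (Fin q), ((Equiv.Perm.sign σ : ℤ) : ℝ) *
        ((∏ j : Fin p, A j (v (σ ⟨2 * j, by omega⟩)) (v (σ ⟨2 * j + 1, by omega⟩))) *
          ∏ i : Fin q, if (i : ℕ) < 2 * p then 1 else a i (v (σ i))) := by
  rw [MultilinearMap.alternatization_apply]
  refine Finset.sum_congr rfl fun σ _ => ?_
  rw [Units.smul_def, ← Int.cast_smul_eq_zsmul ℝ, smul_eq_mul]
  rfl

/-- Wedging `f` with the covector dual to the common vector `b 0` gives a form of top degree on `V`.
Such a form changes by the determinant between two orthonormal bases, which is `±1`. -/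
theorem alternating_adapted_frame (b c : OrthonormalBasis (Fin (m + 1)) ℝ V) (hbc : b 0 = c 0) :
    ∃ ε : ℝ, ε * ε = 1 ∧ ∀ f : V [⋀^Fin m]→ₗ[ℝ] ℝ,
      f (fun i => c i.succ) = ε * f (fun i => b i.succ) := by
  refine ⟨b.toBasis.det c, ?_, fun f => ?_⟩
  · rcases b.det_to_matrix_orthonormalBasis_real c with h | h <;> rw [h] <;> norm_num
  have key : ∀ a : OrthonormalBasis (Fin (m + 1)) ℝ V, a 0 = b 0 →
      AlternatingMap.alternatizeUncurryFin ((innerₛₗ ℝ (b 0)).smulRight f) a =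
        f (fun i => a i.succ) := by
    intro a ha
    rw [AlternatingMap.alternatizeUncurryFin_apply, Finset.sum_eq_single 0]
    · rw [← ha]
      simp only [Fin.val_zero, pow_zero, one_smul, LinearMap.smulRight_apply, innerₛₗ_apply_apply,
        real_inner_self_eq_norm_sq, a.orthonormal.1 0, one_pow]
      rfl
    · intro i _ hi
      rw [← ha]
      simp [a.orthonormal.2 hi.symm]
    · simp
  rw [← key b rfl, ← key c hbc.symm]
  conv_lhs => rw [AlternatingMap.eq_smul_basis_det b.toBasis
    (AlternatingMap.alternatizeUncurryFin ((innerₛₗ ℝ (b 0)).smulRight f))]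
  rw [AlternatingMap.smul_apply, smul_eq_mul, mul_comm, b.coe_toBasis]

/-- An orthonormal frame adapted to a subspace and to a unit vector normal to it. -/
theorem exists_adapted_frame [FiniteDimensional ℝ V] (hdim : Module.finrank ℝ V = m + 1)
    (W : Submodule ℝ V) (e : OrthonormalBasis (Fin (Module.finrank ℝ W)) ℝ W) {u : V}
    (hu : u ∈ Wᗮ) (hu1 : ‖u‖ = 1) :
    ∃ b : OrthonormalBasis (Fin (m + 1)) ℝ V, b 0 = u ∧
      (∀ (i : Fin m) (hi : (i : ℕ) < Module.finrank ℝ W), b i.succ = e ⟨i, hi⟩) ∧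
      ∀ i : Fin m, Module.finrank ℝ W ≤ i → b i.succ ∈ Wᗮ := by
  classical
  -- The zeros are placeholders: only the indices in `s`, where `v` is orthonormal, are prescribed
  -- in the extension to a basis.
  set v : Fin (m + 1) → V := Fin.cons u fun i : Fin m =>
    if h : (i : ℕ) < Module.finrank ℝ W then (e ⟨i, h⟩ : V) else 0 with hv
  set s : Set (Fin (m + 1)) := {i | (i : ℕ) ≤ Module.finrank ℝ W} with hs
  have hu' : ∀ w : W, inner ℝ u (w : V) = 0 := fun w => inner_left_of_mem_orthogonal w.2 hu
  have hsucc : ∀ (i : Fin m) (hi : (i : ℕ) < Module.finrank ℝ W), v i.succ = e ⟨i, hi⟩ := by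
    intro i hi
    simp [hv, hi]
  have hort : Orthonormal ℝ (s.domRestrict v) := by
    rw [orthonormal_iff_ite]
    rintro ⟨i, hi⟩ ⟨j, hj⟩
    change inner ℝ (v i) (v j) = _
    simp only [Subtype.mk.injEq]
    cases i using Fin.cases with
    | zero =>
      cases j using Fin.cases with
      | zero => simp [hv, hu1]
      | succ j =>
        rw [hsucc j (by simpa [hs, Nat.succ_le_iff] using hj), if_neg (Fin.succ_ne_zero j).symm]
        exact hu' _
    | succ i =>
      have hi' : (i : ℕ) < Module.finrank ℝ W := by simpa [hs, Nat.succ_le_iff] using hi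
      cases j using Fin.cases with
      | zero =>
        rw [hsucc i hi', if_neg (Fin.succ_ne_zero i), real_inner_comm]
        exact hu' _
      | succ j =>
        have hj' : (j : ℕ) < Module.finrank ℝ W := by simpa [hs, Nat.succ_le_iff] using hj
        rw [hsucc i hi', hsucc j hj', ← W.coe_inner, orthonormal_iff_ite.1 e.orthonormal]
        simp [Fin.ext_iff]
  obtain ⟨b, hb⟩ := hort.exists_orthonormalBasis_extension_of_card_eq (by simpa using hdim)
  have hbs : ∀ (i : Fin m) (hi : (i : ℕ) < Module.finrank ℝ W), b i.succ = e ⟨i, hi⟩ := by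
    intro i hi
    rw [hb _ (by simpa [hs, Nat.succ_le_iff] using hi), hsucc i hi]
  refine ⟨b, by rw [hb 0 (by simp [hs])]; simp [hv], hbs, fun i hi => ?_⟩
  -- The unit normal forces `dim W ≤ m`, so the whole basis `e` of `W` fits into positions `1, …, m`
  -- of the frame.
  have hW : W ≠ ⊤ := by
    rintro rfl
    rw [top_orthogonal_eq_bot, mem_bot] at hu
    rw [hu] at hu1; simp at hu1
  have hlt : Module.finrank ℝ W < m + 1 := hdim ▸ Submodule.finrank_lt hW
  rw [mem_orthogonal]
  intro w hw
  have hsum := congrArg (fun z : W => (z : V)) (e.sum_repr' ⟨w, hw⟩)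
  simp only [AddSubmonoidClass.coe_finsetSum, SetLike.val_smul] at hsum
  rw [← hsum, sum_inner]
  refine Finset.sum_eq_zero fun l _ => ?_
  rw [inner_smul_left]
  have hl := hbs ⟨l, by omega⟩ l.2
  rw [← hl, b.orthonormal.2, mul_zero]
  intro h
  have := congrArg Fin.val h
  simp at this
  omega

/-- The summand of `φ_{kp}` that belongs to the permutations `τ` of the frame and `σ` of the
arguments. -/
def phiTerm (R : V →ₗ[ℝ] V →ₗ[ℝ] V →ₗ[ℝ] V →ₗ[ℝ] ℝ) (k p : ℕ) (hp : 2 * p ≤ m)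
    (P Q : V →ₗ[ℝ] V) (τ σ : Equiv.Perm (Fin m)) (b c : Fin m → V) : ℝ :=
  (∏ j : Fin p, R (b (τ ⟨2 * j, by omega⟩)) (b (τ ⟨2 * j + 1, by omega⟩))
    (P (c (σ ⟨2 * j, by omega⟩))) (P (c (σ ⟨2 * j + 1, by omega⟩)))) *
  ∏ i : Fin m, if (i : ℕ) < 2 * p then 1 else
    if (i : ℕ) < k then inner ℝ (b (τ i)) (P (c (σ i))) else inner ℝ (b (τ i)) (Q (c (σ i)))

/-- The double alternating sum of the `phiTerm`s. -/
def phiSum (R : V →ₗ[ℝ] V →ₗ[ℝ] V →ₗ[ℝ] V →ₗ[ℝ] ℝ) (k p : ℕ) (hp : 2 * p ≤ m)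
    (P Q : V →ₗ[ℝ] V) (b c : Fin m → V) : ℝ :=
  ∑ τ : Equiv.Perm (Fin m), ((Equiv.Perm.sign τ : ℤ) : ℝ) *
    ∑ σ : Equiv.Perm (Fin m), ((Equiv.Perm.sign σ : ℤ) : ℝ) * phiTerm R k p hp P Q τ σ b c

variable (R : V →ₗ[ℝ] V →ₗ[ℝ] V →ₗ[ℝ] V →ₗ[ℝ] ℝ) (k p : ℕ) (hp : 2 * p ≤ m) (P Q : V →ₗ[ℝ] V)

/-- `phiSum` is alternating in the frame. -/
theorem exists_alternating_frame (c : Fin m → V) :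
    ∃ f : V [⋀^Fin m]→ₗ[ℝ] ℝ, ∀ b, f b = phiSum R k p hp P Q b c := by
  refine ⟨∑ σ : Equiv.Perm (Fin m), ((Equiv.Perm.sign σ : ℤ) : ℝ) •
    MultilinearMap.alternatization (tensorProd hp
      (fun j => LinearMap.mk₂ ℝ (fun x y => R x y (P (c (σ ⟨2 * j, by omega⟩)))
        (P (c (σ ⟨2 * j + 1, by omega⟩)))) (by simp) (by simp) (by simp) (by simp))
      (fun i => if (i : ℕ) < k then innerₛₗ ℝ (P (c (σ i))) else innerₛₗ ℝ (Q (c (σ i))))),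
    fun b => ?_⟩
  simp only [alternating_sum_apply, AlternatingMap.smul_apply, smul_eq_mul, phiSum, Finset.mul_sum]
  rw [Finset.sum_comm]
  refine Finset.sum_congr rfl fun σ _ => ?_
  rw [alternatization_tensorProd_apply, Finset.mul_sum]
  refine Finset.sum_congr rfl fun τ _ => ?_
  rw [mul_left_comm]
  congr 2
  simp only [phiTerm, LinearMap.mk₂_apply]
  congr 1
  refine Finset.prod_congr rfl fun i _ => ?_
  split_ifs <;> simp [real_inner_comm]

/-- `phiSum` is alternating in the arguments. -/
theorem exists_alternating_arguments (b : Fin m → V) :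
    ∃ f : V [⋀^Fin m]→ₗ[ℝ] ℝ, ∀ c, f c = phiSum R k p hp P Q b c := by
  refine ⟨∑ τ : Equiv.Perm (Fin m), ((Equiv.Perm.sign τ : ℤ) : ℝ) •
    MultilinearMap.alternatization (tensorProd hp
      (fun j => (R (b (τ ⟨2 * j, by omega⟩)) (b (τ ⟨2 * j + 1, by omega⟩))).compl₁₂ P P)
      (fun i => if (i : ℕ) < k then innerₛₗ ℝ (b (τ i)) ∘ₗ P else innerₛₗ ℝ (b (τ i)) ∘ₗ Q)),
    fun c => ?_⟩
  simp only [alternating_sum_apply, AlternatingMap.smul_apply, smul_eq_mul, phiSum]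
  refine Finset.sum_congr rfl fun τ _ => ?_
  rw [alternatization_tensorProd_apply]
  congr 1
  refine Finset.sum_congr rfl fun σ _ => ?_
  congr 1
  simp only [phiTerm, LinearMap.compl₁₂_apply]
  congr 1
  refine Finset.prod_congr rfl fun i _ => ?_
  split_ifs <;> simp

/-- The frame enters twice, in the coefficients and in the arguments. Each change contributes the
same sign `ε`, and `ε² = 1`. -/
theorem phiSum_adapted_frame (b c : OrthonormalBasis (Fin (m + 1)) ℝ V) (hbc : b 0 = c 0) :
    phiSum R k p hp P Q (fun i => c i.succ) (fun i => c i.succ) =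
      phiSum R k p hp P Q (fun i => b i.succ) (fun i => b i.succ) := by
  obtain ⟨ε, hε, h⟩ := alternating_adapted_frame b c hbc
  obtain ⟨f, hf⟩ := exists_alternating_frame R k p hp P Q fun i => c i.succ
  obtain ⟨g, hg⟩ := exists_alternating_arguments R k p hp P Q fun i => b i.succ
  rw [← hf, h, hf, ← hg, h, hg, ← mul_assoc, hε, one_mul]

/-- Two permutations that respect the splittings of the index set at `k` and at `d` in the
indicated way force the splittings to coincide. -/
theorem lt_iff_of_perm {d : ℕ} (τ σ : Equiv.Perm (Fin m))
    (hτ : ∀ i : Fin m, k ≤ i → d ≤ τ i) (hσ : ∀ i : Fin m, (i : ℕ) < k → (σ i : ℕ) < d)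
    (i : Fin m) : ((i : ℕ) < k ↔ (i : ℕ) < d) ∧ ((i : ℕ) < k ↔ (τ i : ℕ) < d) := by
  classical
  set S : ℕ → Finset (Fin m) := fun n => Finset.univ.filter fun i => (i : ℕ) < n with hS
  -- Injectivity of `σ` bounds the number of indices below `k` by the number below `d`, and that of
  -- `τ` bounds the complements in the same direction. Hence all inclusions are equalities.
  have h1 : (S k).card ≤ (S d).card :=
    Finset.card_le_card_of_injOn σ (fun i hi => by simpa [hS] using hσ i (by simpa [hS] using hi))
      σ.injective.injOn
  have h2 : (S k)ᶜ.image τ ⊆ (S d)ᶜ := by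
    intro i hi
    obtain ⟨j, hj, rfl⟩ := Finset.mem_image.1 hi
    simp only [hS, Finset.mem_compl, Finset.mem_filter, Finset.mem_univ, true_and, not_lt] at hj ⊢
    exact hτ j hj
  have h3 : (S k)ᶜ.card ≤ (S d)ᶜ.card := by
    have := Finset.card_le_card h2
    rwa [Finset.card_image_of_injective _ τ.injective] at this
  have h4 : (S k).card = (S d).card := by
    rw [Finset.card_compl, Finset.card_compl] at h3
    have := Finset.card_le_univ (S d)
    have := Finset.card_le_univ (S k)
    omega
  have h5 : S k = S d := by
    rcases le_total k d with h | h
    · refine Finset.eq_of_subset_of_card_le (fun i hi => ?_) h4.ge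
      simp only [hS, Finset.mem_filter, Finset.mem_univ, true_and] at hi ⊢
      omega
    · refine (Finset.eq_of_subset_of_card_le (fun i hi => ?_) h4.le).symm
      simp only [hS, Finset.mem_filter, Finset.mem_univ, true_and] at hi ⊢
      omega
  have h6 : (S k)ᶜ.image τ = (S d)ᶜ :=
    Finset.eq_of_subset_of_card_le h2
      (by rw [Finset.card_image_of_injective _ τ.injective, h5])
  constructor
  · simpa [hS] using Finset.ext_iff.1 h5 i
  · have := Finset.ext_iff.1 h6 (τ i)
    rw [Finset.mem_image] at this
    simp only [hS, Finset.mem_compl, Finset.mem_filter, Finset.mem_univ, true_and, not_lt,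
      EmbeddingLike.apply_eq_iff_eq, exists_eq_right] at this
    omega

variable [FiniteDimensional ℝ V]

/-- Along a face with direction `W`, and for frames that extend a given frame `e` of `W` by normal
vectors, the terms of `φ_{kp}` depend only on `e`. -/
theorem phiTerm_congr (hpk : 2 * p ≤ k) (W : Submodule ℝ V) {d : ℕ} (e : Fin d → V)
    (he : ∀ i, e i ∈ W) (τ σ : Equiv.Perm (Fin m)) (b c : Fin m → V)
    (hb : Orthonormal ℝ b) (hc : Orthonormal ℝ c)
    (hbe : ∀ (i : Fin m) (hi : (i : ℕ) < d), b i = e ⟨i, hi⟩)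
    (hce : ∀ (i : Fin m) (hi : (i : ℕ) < d), c i = e ⟨i, hi⟩)
    (hbW : ∀ i : Fin m, d ≤ i → b i ∈ Wᗮ) (hcW : ∀ i : Fin m, d ≤ i → c i ∈ Wᗮ) :
    phiTerm R k p hp W.starProjection.toLinearMap Wᗮ.starProjection.toLinearMap τ σ b b =
      phiTerm R k p hp W.starProjection.toLinearMap Wᗮ.starProjection.toLinearMap τ σ c c := by
  by_cases hτ : ∀ i : Fin m, k ≤ i → d ≤ τ i
  swap
  -- Some factor of type `ω` pairs a frame vector of `W` with a vector of `Wᗮ`. Position `i` lies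
  -- beyond the curvature slots because `2p ≤ k ≤ i`.
  · push Not at hτ
    obtain ⟨i, hi, hi'⟩ := hτ
    have hzero : ∀ a : Fin m → V, (∀ (i : Fin m) (hi : (i : ℕ) < d), a i = e ⟨i, hi⟩) →
        phiTerm R k p hp W.starProjection.toLinearMap Wᗮ.starProjection.toLinearMap τ σ a a =
          0 := by
      intro a ha
      rw [phiTerm, Finset.prod_eq_zero (Finset.mem_univ i), mul_zero]
      rw [if_neg (by omega), if_neg (by omega), ha _ hi']
      exact inner_right_of_mem_orthogonal (he _) (Wᗮ.starProjection_apply_mem _)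
    rw [hzero b hbe, hzero c hce]
  by_cases hσ : ∀ i : Fin m, (i : ℕ) < k → (σ i : ℕ) < d
  swap
  -- Some curvature or `θ` factor has a normal argument, which the projection to `W` kills.
  · push Not at hσ
    obtain ⟨i, hi, hi'⟩ := hσ
    have hzero : ∀ a : Fin m → V, (∀ i : Fin m, d ≤ i → a i ∈ Wᗮ) →
        phiTerm R k p hp W.starProjection.toLinearMap Wᗮ.starProjection.toLinearMap τ σ a a =
          0 := by
      intro a ha
      have h0 : W.starProjection.toLinearMap (a (σ i)) = 0 :=
        (starProjection_apply_eq_zero_iff W).2 (ha _ hi')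
      rw [phiTerm]
      by_cases hip : (i : ℕ) < 2 * p
      · rw [Finset.prod_eq_zero (Finset.mem_univ (⟨i / 2, by omega⟩ : Fin p)), zero_mul]
        rcases Nat.mod_two_eq_zero_or_one (i : ℕ) with hm | hm
        · have e1 : (⟨2 * (i / 2), by omega⟩ : Fin m) = i := Fin.ext (by simp; omega)
          simp only [e1, h0, map_zero, LinearMap.zero_apply]
        · have e1 : (⟨2 * (i / 2) + 1, by omega⟩ : Fin m) = i := Fin.ext (by simp; omega)
          simp only [e1, h0, map_zero]
      · rw [Finset.prod_eq_zero (Finset.mem_univ i), mul_zero]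
        rw [if_neg hip, if_pos hi, h0, inner_zero_right]
    rw [hzero b hbW, hzero c hcW]
  have hiff := lt_iff_of_perm k τ σ hτ hσ
  have hτe : ∀ i : Fin m, (i : ℕ) < k → b (τ i) = c (τ i) := fun i hi => by
    have h := ((hiff i).2).1 hi
    rw [hbe _ h, hce _ h]
  have hσe : ∀ i : Fin m, (i : ℕ) < k → b (σ i) = c (σ i) := fun i hi => by
    rw [hbe _ (hσ i hi), hce _ (hσ i hi)]
  rw [phiTerm, phiTerm]
  congr 1
  · refine Finset.prod_congr rfl fun j _ => ?_
    have h1 : 2 * (j : ℕ) < k := by omega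
    have h2 : 2 * (j : ℕ) + 1 < k := by omega
    rw [hτe _ h1, hτe _ h2, hσe _ h1, hσe _ h2]
  · refine Finset.prod_congr rfl fun i _ => ?_
    split_ifs with h1 h2
    · rfl
    · rw [hτe i h2, hσe i h2]
    -- The factors of type `ω` are Kronecker symbols, whichever normal vectors complete the frame.
    · have key : ∀ a : Fin m → V, Orthonormal ℝ a → (∀ i : Fin m, d ≤ i → a i ∈ Wᗮ) →
          inner ℝ (a (τ i)) (Wᗮ.starProjection.toLinearMap (a (σ i))) =
            if τ i = σ i then 1 else 0 := by
        intro a ha haW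
        have hm := haW _ (hτ i (not_lt.1 h2))
        rw [← orthonormal_iff_ite.1 ha]
        change inner ℝ (a (τ i)) (Wᗮ.starProjection (a (σ i))) = _
        rw [← inner_starProjection_left_eq_right, starProjection_eq_self_iff.2 hm]
      rw [key b hb hbW, key c hc hcW]

/-- The value of `φ_{kp}` on the normal cycle of a polytope depends only on the direction of the
face. -/
theorem phiSum_face_eq (hdim : Module.finrank ℝ V = m + 1) (hpk : 2 * p ≤ k) (W : Submodule ℝ V)
    (b c : OrthonormalBasis (Fin (m + 1)) ℝ V) (hb : b 0 ∈ Wᗮ) (hc : c 0 ∈ Wᗮ) :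
    phiSum R k p hp W.starProjection.toLinearMap Wᗮ.starProjection.toLinearMap
        (fun i => b i.succ) (fun i => b i.succ) =
      phiSum R k p hp W.starProjection.toLinearMap Wᗮ.starProjection.toLinearMap
        (fun i => c i.succ) (fun i => c i.succ) := by
  set e := stdOrthonormalBasis ℝ W
  obtain ⟨b', hb0, hbe, hbW⟩ := exists_adapted_frame hdim W e hb (b.orthonormal.1 0)
  obtain ⟨c', hc0, hce, hcW⟩ := exists_adapted_frame hdim W e hc (c.orthonormal.1 0)
  -- Both frames are exchanged for ones that contain the same basis of `W`, without changing the
  -- unit normals.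
  rw [← phiSum_adapted_frame R k p hp _ _ b b' hb0.symm,
    ← phiSum_adapted_frame R k p hp _ _ c c' hc0.symm, phiSum, phiSum]
  refine Finset.sum_congr rfl fun τ _ => ?_
  congr 1
  refine Finset.sum_congr rfl fun σ _ => ?_
  congr 1
  exact phiTerm_congr R k p hp hpk W (fun i => (e i : V)) (fun i => (e i).2) τ σ _ _
    (b'.orthonormal.comp _ (Fin.succ_injective m)) (c'.orthonormal.comp _ (Fin.succ_injective m))
    hbe hce hbW hcW

end FaceForms

/-! ### Horizontal and vertical lifts -/

section Lift

open Filter Topology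

variable {E : Type*} [NormedAddCommGroup E] [NormedSpace ℝ E]
  {M : Type*} [TopologicalSpace M] [ChartedSpace E M] [IsManifold 𝓘(ℝ, E) ∞ M]

/-- In the preferred charts, the projection of the tangent bundle is the projection
`E × E → E`. -/
theorem hasMFDerivAt_proj (ξ : TangentBundle 𝓘(ℝ, E) M) :
    HasMFDerivAt 𝓘(ℝ, E).tangent 𝓘(ℝ, E)
      (Bundle.TotalSpace.proj : TangentBundle 𝓘(ℝ, E) M → M) ξ
      (ContinuousLinearMap.fst ℝ E E) := by
  refine ⟨(FiberBundle.continuous_proj E (TangentSpace 𝓘(ℝ, E) : M → Type _)).continuousAt, ?_⟩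
  have h1 : HasFDerivWithinAt (Prod.fst : E × E → E) (ContinuousLinearMap.fst ℝ E E)
      (Set.range 𝓘(ℝ, E).tangent) (extChartAt 𝓘(ℝ, E).tangent ξ ξ) := hasFDerivWithinAt_fst
  have h2 : ∀ z ∈ (extChartAt 𝓘(ℝ, E).tangent ξ).target,
      writtenInExtChartAt 𝓘(ℝ, E).tangent 𝓘(ℝ, E) ξ
        (Bundle.TotalSpace.proj : TangentBundle 𝓘(ℝ, E) M → M) z = z.1 := by
    intro z hz
    have h3 := (extChartAt 𝓘(ℝ, E).tangent ξ).right_inv hz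
    have h4 := (extChartAt 𝓘(ℝ, E).tangent ξ).map_target hz
    set η := (extChartAt 𝓘(ℝ, E).tangent ξ).symm z with hη
    have h5 := congrArg Prod.fst h3
    rw [FiberBundle.extChartAt] at h5 h4
    rw [← h5]
    have h6 : η ∈ (trivializationAt E (TangentSpace 𝓘(ℝ, E)) ξ.proj).source :=
      h4.1
    simp only [writtenInExtChartAt, Function.comp_apply]
    rw [← hη]
    change _ = extChartAt 𝓘(ℝ, E) ξ.proj
      (trivializationAt E (TangentSpace 𝓘(ℝ, E)) ξ.proj η).1
    rw [Bundle.Trivialization.coe_fst _ h6]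
  refine h1.congr_of_eventuallyEq ?_ (h2 _ (mem_extChartAt_target ξ))
  filter_upwards [extChartAt_target_mem_nhdsWithin (I := 𝓘(ℝ, E).tangent) ξ] with z hz
  exact h2 z hz

variable [Bundle.RiemannianBundle (fun x : M => TangentSpace 𝓘(ℝ, E) x)]

theorem projDeriv_liftMap (x : M) (u : TangentSpace 𝓘(ℝ, E) x)
    (v : TangentSpace 𝓘(ℝ, E) x × TangentSpace 𝓘(ℝ, E) x) :
    projDeriv (⟨x, u⟩ : TangentBundle 𝓘(ℝ, E) M) (liftMap x u v) = v.1 := by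
  unfold projDeriv
  rw [(hasMFDerivAt_proj (⟨x, u⟩ : TangentBundle 𝓘(ℝ, E) M)).mfderiv]
  rfl

theorem connectionMap_liftMap (x : M) (u : TangentSpace 𝓘(ℝ, E) x)
    (v : TangentSpace 𝓘(ℝ, E) x × TangentSpace 𝓘(ℝ, E) x) :
    connectionMap (⟨x, u⟩ : TangentBundle 𝓘(ℝ, E) M) (liftMap x u v) = v.2 := by
  have h : ∀ a b : E, a - b + b = a := sub_add_cancel
  exact h _ _

theorem curvatureTensor_add (g : E → E →L[ℝ] E →L[ℝ] ℝ) (z u v w w' : E) :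
    curvatureTensor g z u v (w + w') = curvatureTensor g z u v w + curvatureTensor g z u v w' := by
  simp only [curvatureTensor, map_add]
  abel

theorem curvatureTensor_smul (g : E → E →L[ℝ] E →L[ℝ] ℝ) (z u v w : E) (t : ℝ) :
    curvatureTensor g z u v (t • w) = t • curvatureTensor g z u v w := by
  simp only [curvatureTensor, map_smul, smul_sub, smul_add]

theorem curvatureForm_apply (x : M) (b c v w : TangentSpace 𝓘(ℝ, E) x) :
    curvatureForm x b c v w = innerₛₗ ℝ b (curvatureTensor (E := E) (chartMetric x)
      (extChartAt 𝓘(ℝ, E) x x) v w c : TangentSpace 𝓘(ℝ, E) x) := rfl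

/-- The curvature form `Ω(b, c)(v, w)` as a quadrilinear form. -/
def curvatureQuadrilinear (x : M) :
    TangentSpace 𝓘(ℝ, E) x →ₗ[ℝ] TangentSpace 𝓘(ℝ, E) x →ₗ[ℝ]
      TangentSpace 𝓘(ℝ, E) x →ₗ[ℝ] TangentSpace 𝓘(ℝ, E) x →ₗ[ℝ] ℝ :=
  LinearMap.mk₂ ℝ (curvatureForm x)
    (fun b b' c => LinearMap.ext₂ fun v w => by
      rw [LinearMap.add_apply, LinearMap.add_apply, curvatureForm_apply, map_add]
      rfl)
    (fun t b c => LinearMap.ext₂ fun v w => by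
      rw [LinearMap.smul_apply, LinearMap.smul_apply, curvatureForm_apply, map_smul]
      rfl)
    (fun b c c' => LinearMap.ext₂ fun v w => by
      rw [LinearMap.add_apply, LinearMap.add_apply, curvatureForm_apply]
      exact (congrArg (innerₛₗ ℝ b) (curvatureTensor_add (E := E) (chartMetric x)
        (extChartAt 𝓘(ℝ, E) x x) v w c c')).trans (map_add (innerₛₗ ℝ b) _ _))
    (fun t b c => LinearMap.ext₂ fun v w => by
      rw [LinearMap.smul_apply, LinearMap.smul_apply, curvatureForm_apply]
      exact (congrArg (innerₛₗ ℝ b) (curvatureTensor_smul (E := E) (chartMetric x)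
        (extChartAt 𝓘(ℝ, E) x x) v w c t)).trans (map_smul (innerₛₗ ℝ b) _ _))

/-- The projection and the connection map recover the horizontal and vertical components of a lift.
The power of two is the normalization of the wedge product of two-forms. -/
theorem phiFrame_liftMap {m : ℕ} (k p : ℕ) (hp : 2 * p ≤ m) (x : M) (u : TangentSpace 𝓘(ℝ, E) x)
    (b : OrthonormalBasis (Fin (m + 1)) ℝ (TangentSpace 𝓘(ℝ, E) x))
    (P Q : TangentSpace 𝓘(ℝ, E) x →ₗ[ℝ] TangentSpace 𝓘(ℝ, E) x)
    (c : Fin m → TangentSpace 𝓘(ℝ, E) x) :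
    phiFrame k p hp (⟨x, u⟩ : TangentBundle 𝓘(ℝ, E) M) b
        (fun i => liftMap x u (P (c i), Q (c i))) =
      ((2 : ℝ) ^ p)⁻¹ *
        phiSum (curvatureQuadrilinear x) k p hp P Q (fun i => b i.succ) c := by
  rw [phiFrame, alternating_sum_apply, phiSum, Finset.mul_sum]
  refine Finset.sum_congr rfl fun τ _ => ?_
  rw [AlternatingMap.smul_apply, wedge, AlternatingMap.smul_apply, smul_eq_mul, smul_eq_mul,
    alternatization_tensorProd_apply, mul_left_comm]
  congr 2
  refine Finset.sum_congr rfl fun σ _ => ?_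
  congr 1
  rw [phiTerm]
  congr 1
  · refine Finset.prod_congr rfl fun j _ => ?_
    rw [bigOmega, LinearMap.compl₁₂_apply, projDeriv_liftMap, projDeriv_liftMap]
    rfl
  · refine Finset.prod_congr rfl fun i _ => ?_
    split_ifs
    · rfl
    · rw [theta, LinearMap.comp_apply, projDeriv_liftMap]
      rfl
    · rw [omegaZero, LinearMap.comp_apply, connectionMap_liftMap]
      rfl

end Lift

/-! ### Cancellation of orientation signs -/

section Angular

variable {V : Type*} [NormedAddCommGroup V] [InnerProductSpace ℝ V] {m : ℕ}

theorem frameSign_mul_self (o : Orientation ℝ V (Fin (m + 1)))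
    (b : OrthonormalBasis (Fin (m + 1)) ℝ V) : frameSign o b * frameSign o b = 1 := by
  unfold frameSign
  split_ifs <;> norm_num

/-- The signs cancel when a form defined by adapted frames is evaluated on adapted frames. -/
theorem exists_adaptedFrameValue_eq [FiniteDimensional ℝ V] (hdim : Module.finrank ℝ V = m + 1)
    (o : Orientation ℝ V (Fin (m + 1))) {U : Type*} [AddCommGroup U] [Module ℝ U] {u : V}
    (hu : ‖u‖ = 1) (C : ℝ)
    (Φ : OrthonormalBasis (Fin (m + 1)) ℝ V → U [⋀^Fin m]→ₗ[ℝ] ℝ)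
    (v : OrthonormalBasis (Fin (m + 1)) ℝ V → Fin m → U) :
    ∃ b : OrthonormalBasis (Fin (m + 1)) ℝ V, b 0 = u ∧
      adaptedFrameValue o u (fun b => (C • adaptedFrameValue o u Φ) (v b)) = C * Φ b (v b) := by
  have h : ∃ b : OrthonormalBasis (Fin (m + 1)) ℝ V, b 0 = u := by
    obtain ⟨b, hb, -⟩ := exists_adapted_frame hdim ⊥ (stdOrthonormalBasis ℝ _) (u := u)
      (by simp) hu
    exact ⟨b, hb⟩
  refine ⟨h.choose, h.choose_spec, ?_⟩
  -- Both frame values use the same chosen frame, so the orientation sign occurs squared.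
  simp only [adaptedFrameValue, dif_pos h]
  rw [AlternatingMap.smul_apply, AlternatingMap.smul_apply, smul_comm,
    smul_smul (frameSign o _), frameSign_mul_self, one_smul, smul_eq_mul]

end Angular

end RiemCurv

end


/-! ### Angularity of the Riemannian curvature measures -/

theorem mainTheorem12 {E : Type*} [NormedAddCommGroup E] [NormedSpace ℝ E] [FiniteDimensional ℝ E]
    {M : Type*} [TopologicalSpace M] [ChartedSpace E M] [IsManifold 𝓘(ℝ, E) ∞ M]
    [Bundle.RiemannianBundle (fun x : M => TangentSpace 𝓘(ℝ, E) x)]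
    [IsContMDiffRiemannianBundle 𝓘(ℝ, E) ∞ E (fun x : M => TangentSpace 𝓘(ℝ, E) x)]
    (m : ℕ) (hdim : Module.finrank ℝ E = m + 1)
    (o : ∀ x : M, Orientation ℝ (TangentSpace 𝓘(ℝ, E) x) (Fin (m + 1)))
    (k p : ℕ) (hp : 2 * p ≤ k) :
    (RiemCurv.curvC (E := E) o k p hp).IsAngular o := by
  classical
  intro x
  have hdim' : Module.finrank ℝ (TangentSpace 𝓘(ℝ, E) x) = m + 1 := hdim
  by_cases hk : k < m + 1
  · have hpm : 2 * p ≤ m := by omega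
    set C : ℝ := RiemCurv.ballVol k /
      (Real.pi ^ k * (m + 1 - k).factorial * RiemCurv.ballVol (m + 1 - k)) with hC
    set ψ := (RiemCurv.FormPair.transfer (RiemCurv.curvC (E := E) o k p hp) x).sphereForm with hψ
    have key : ∀ (W : Submodule ℝ (TangentSpace 𝓘(ℝ, E) x)) (u : TangentSpace 𝓘(ℝ, E) x),
        u ∈ Wᗮ → ‖u‖ = 1 →
        ∃ b : OrthonormalBasis (Fin (m + 1)) ℝ (TangentSpace 𝓘(ℝ, E) x), b 0 = u ∧
          RiemCurv.faceValue (o x) ψ W u = C * (((2 : ℝ) ^ p)⁻¹ *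
            RiemCurv.phiSum (RiemCurv.curvatureQuadrilinear x) k p hpm
              W.starProjection.toLinearMap Wᗮ.starProjection.toLinearMap
              (fun i => b i.succ) (fun i => b i.succ)) := by
      intro W u _ hu
      obtain ⟨b, hb, h⟩ := RiemCurv.exists_adaptedFrameValue_eq hdim' (o x) hu C
        (RiemCurv.phiFrame k p hpm (⟨x, u⟩ : TangentBundle 𝓘(ℝ, E) M))
        (fun b i => RiemCurv.liftMap x u
          (W.starProjection (b i.succ), Wᗮ.starProjection (b i.succ)))
      refine ⟨b, hb, ?_⟩
      rw [← RiemCurv.phiFrame_liftMap k p hpm x u b]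
      refine Eq.trans ?_ h
      have hs : (RiemCurv.curvC (E := E) o k p hp).sphereForm ⟨x, u⟩ =
          C • RiemCurv.adaptedFrameValue (o x) u (RiemCurv.phiFrame k p hpm ⟨x, u⟩) := dif_pos hk
      rw [← hs]
      rfl
    -- The coefficient is read off at an arbitrary unit normal of `W`; the value `0` occurs only if
    -- `W` has none.
    refine RiemCurv.isAngular_of_faceValue hdim' (o x) _ ?_
      (fun W => if h : ∃ u ∈ Wᗮ, ‖u‖ = 1 then RiemCurv.faceValue (o x) ψ W h.choose else 0) ?_
    · exact dif_neg (by omega)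
    · intro W u hu hu1
      have h : ∃ u ∈ Wᗮ, ‖u‖ = 1 := ⟨u, hu, hu1⟩
      rw [dif_pos h]
      obtain ⟨b, hb, e⟩ := key W u hu hu1
      obtain ⟨c, hc, e'⟩ := key W h.choose h.choose_spec.1 h.choose_spec.2
      rw [e, e', RiemCurv.phiSum_face_eq _ k p hpm hdim' hp W b c (hb ▸ hu)
        (hc ▸ h.choose_spec.1)]
  -- This covers `k = m + 1` and `k > m + 1` together: the form on the sphere bundle vanishes in
  -- both cases.
  · refine RiemCurv.isAngular_of_sphereForm_eq_zero (o x) _ fun u => ?_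
    have h : (RiemCurv.curvC (E := E) o k p hp).sphereForm ⟨x, u⟩ = 0 := dif_neg hk
    change ((RiemCurv.curvC (E := E) o k p hp).sphereForm ⟨x, u⟩).compLinearMap
      (RiemCurv.liftMap x u) = 0
    rw [h]
    rfl
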